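/- Manifolds are smooth, finite-dimensional, Hausdorff and second-countable, and carry the diffeology whose plots are the smooth maps. A subset $L$ of a manifold $N$ is a weakly-embedded submanifold if its subspace diffeology is the diffeology of a manifold structure on $L$ (this structure is then unique) and, with it, the inclusion $L\hookrightarrow N$ is an immersion. A (Stefan) singular foliation $\mathcal F$ of an $n$-dimensional manifold $N$ is a partition of $N$ into connected weakly-embedded submanifolds, called leaves, such that about each $x\in N$ there is a diffeomorphism $\psi:V\to U\times W$ from an open neighbourhood $V$ of $x$, where $U\subseteq\mathbb R^k$ and $W\subseteq\mathbb R^{n-k}$ are open neighbourhoods of the origin and $k$ is the dimension of the leaf through $x$, with $\psi(x)=(0,0)$ and such that for every leaf $L$ one has $\psi(L\cap V)=U\times\ell$ for some $\ell\subseteq W$. Two singular foliations $(N_0,\mathcal F_0)$ and $(N_1,\mathcal F_1)$ are Molino transverse equivalent if there are a singular foliation $(M,\mathcal F)$ and surjective submersions $p_i:M\to N_i$ ($i=0,1$) with connected fibers such that, for both $i$, the leaves of $\mathcal F$ are exactly the sets $p_i^{-1}(L)$ with $L$ a leaf of $\mathcal F_i$. For a singular foliation $(N,\mathcal F)$, let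 $\Omega_b^\bullet(N,\mathcal F)$ be the complex of basic forms, that is, of the smooth differential forms $\alpha$ on $N$ with $\iota_X\alpha=0$ and $\mathcal L_X\alpha=0$ for every smooth vector field $X$ on $N$ tangent to the leaves, with the exterior derivative. Let $\pi:N\to N/\mathcal F$ be the quotient map onto the leaf space, which carries the quotient diffeology (its plots are the maps that lift locally along $\pi$ to smooth maps into $N$), and let $\Omega^\bullet(N/\mathcal F)$ be the complex of diffeological differential forms on $N/\mathcal F$ (a form assigns to each plot a smooth form on the domain of the plot, compatibly with smooth reparametrization; the differential is taken plotwise). For $\alpha\in\Omega^\bullet(N/\mathcal F)$, the pullback $\pi^*\alpha$ is the form on $N$ with $q^*(\pi^*\alpha)=\alpha(\pi\circ q)$ for every plot $q$ of $N$. Proposition 11. Let $(N_0,\mathcal F_0)$ and $(N_1,\mathcal F_1)$ be Molino transverse equivalent singular foliations, with quotient maps $\pi_i:N_i\to N_i/\mathcal F_i$. If $\pi_0^*$ is an isomorphism of complexes $\Omega^\bullet(N_0/\mathcal F_0)\to\Omega_b^\bullet(N_0,\mathcal F_0)$, then $\pi_1^*$ is an isomorphism of complexes $\Omega^\bullet(N_1/\mathcal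 F_1)\to\Omega_b^\bullet(N_1,\mathcal F_1)$. -/

import Mathlib

open scoped Manifold ContDiff Topology

universe u v w

namespace SingFol

noncomputable section

/-- The Cartesian space `ℝⁿ`. -/
abbrev Cart (n : ℕ) : Type := EuclideanSpace ℝ (Fin n)

/-! ### Diffeologies: manifolds, subsets, and diffeological differential forms -/

/-- The diffeology of a manifold: the plots are the smooth maps from Cartesian spaces. -/
@[reducible]
def manifoldDiffeology (m : ℕ) (M : Type u) [TopologicalSpace M] [ChartedSpace (Cart m) M] :
    DiffeologicalSpace M :=
  DiffeologicalSpace.ofCorePlotsOn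
    { isPlotOn := fun {n s} _ p ↦ ContMDiffOn (𝓡 n) (𝓡 m) ∞ p s
      isPlotOn_congr := fun _ _ _ h ↦ contMDiffOn_congr h
      isPlot_const := fun _ ↦ contMDiffOn_const
      isPlotOn_reparam := fun _ _ _ h hp hf ↦ hp.comp hf.contMDiffOn h
      locality := fun _ _ h x hx ↦ by
        obtain ⟨t, ht, hxt, hpt⟩ := h x hx
        exact ((hpt x hxt).contMDiffAt (ht.mem_nhds hxt)).contMDiffWithinAt }

/-- The underlying set of a subset `L ⊆ M`, as a bare type. It deliberately carries no topology:
the topology of a leaf is usually finer than the subspace topology. -/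
def Carrier {M : Type u} (L : Set M) : Type u := {x : M // x ∈ L}

/-- The inclusion `L → M`. -/
def Carrier.incl {M : Type u} (L : Set M) : Carrier L → M := Subtype.val

/-- The subspace diffeology on a subset `L` of a manifold `M`: the plots are the maps into `L`
that are smooth as maps into `M`. -/
@[reducible]
def subsetDiffeology (m : ℕ) {M : Type u} [TopologicalSpace M] [ChartedSpace (Cart m) M]
    (L : Set M) : DiffeologicalSpace (Carrier L) :=
  DiffeologicalSpace.ofCorePlotsOn
    { isPlotOn := fun {n s} _ p ↦ ContMDiffOn (𝓡 n) (𝓡 m) ∞ (Carrier.incl L ∘ p) s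
      isPlotOn_congr := fun _ _ _ h ↦ contMDiffOn_congr fun x hx ↦ congrArg _ (h hx)
      isPlot_const := fun _ ↦ contMDiffOn_const
      isPlotOn_reparam := fun _ _ _ h hp hf ↦ hp.comp hf.contMDiffOn h
      locality := fun _ _ h x hx ↦ by
        obtain ⟨t, ht, hxt, hpt⟩ := h x hx
        exact ((hpt x hxt).contMDiffAt (ht.mem_nhds hxt)).contMDiffWithinAt }

/-- Diffeological differential `k`-forms on a diffeological space `X`: families `α` that assign to
each plot `p : ℝⁿ → X` a smooth `k`-form `α p` on `ℝⁿ`, such that `α (p ∘ f) = f^* (α p)` for every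
smooth `f : ℝˡ → ℝⁿ`. -/
def DiffeoForm (X : Type u) [DiffeologicalSpace X] (k : ℕ) :
    Submodule ℝ (∀ n : ℕ, {p : Cart n → X // Diffeology.IsPlot p} →
      Cart n → Cart n [⋀^Fin k]→L[ℝ] ℝ) where
  carrier := {α | (∀ n p, ContDiff ℝ ∞ (α n p)) ∧
    ∀ (n l : ℕ) (p : {p : Cart n → X // Diffeology.IsPlot p}) (f : Cart l → Cart n)
      (hf : ContDiff ℝ ∞ f) (z : Cart l),
      α l ⟨p.1 ∘ f, Diffeology.isPlot_reparam p.2 hf⟩ z =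
        (α n p (f z)).compContinuousLinearMap (fderiv ℝ f z)}
  add_mem' := by
    rintro α β ⟨ha, ha'⟩ ⟨hb, hb'⟩
    refine ⟨fun n p ↦ (ha n p).add (hb n p), fun n l p f hf z ↦ ?_⟩
    simp only [Pi.add_apply, ha' n l p f hf z, hb' n l p f hf z]
    rfl
  zero_mem' := by
    refine ⟨fun n p ↦ contDiff_const, fun n l p f hf z ↦ ?_⟩
    rfl
  smul_mem' := by
    rintro c α ⟨ha, ha'⟩
    refine ⟨fun n p ↦ (ha n p).const_smul c, fun n l p f hf z ↦ ?_⟩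
    simp only [Pi.smul_apply, ha' n l p f hf z]
    rfl

theorem contDiff_extDeriv {n k : ℕ} {η : Cart n → Cart n [⋀^Fin k]→L[ℝ] ℝ}
    (h : ContDiff ℝ ∞ η) : ContDiff ℝ ∞ (extDeriv η) := by
  have h1 : ContDiff ℝ ∞ (fderiv ℝ η) := h.fderiv_right (m := ∞) (by simp)
  exact (ContinuousAlternatingMap.alternatizeUncurryFinCLM ℝ (Cart n) ℝ (n := k)).contDiff.comp h1

/-- The exterior derivative of diffeological forms: `(dα) p = d (α p)` for every plot `p`. -/
def DiffeoForm.d {X : Type u} [DiffeologicalSpace X] {k : ℕ} (α : DiffeoForm X k) :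
    DiffeoForm X (k + 1) :=
  ⟨fun n p ↦ extDeriv (α.1 n p), fun n p ↦ contDiff_extDeriv (α.2.1 n p),
    fun n l p f hf z ↦ by
      have h : α.1 l ⟨p.1 ∘ f, Diffeology.isPlot_reparam p.2 hf⟩ =
          fun z ↦ (α.1 n p (f z)).compContinuousLinearMap (fderiv ℝ f z) :=
        funext fun z ↦ α.2.2 n l p f hf z
      simp only [h]
      exact extDeriv_pullback (r := ∞) ((α.2.1 n p).differentiable (by simp) _) hf.contDiffAt
        (by simpa using (WithTop.coe_le_coe.2 le_top : ((2 : ℕ∞) : WithTop ℕ∞) ≤ ∞))⟩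

/-! ### Differential forms and Lie derivatives on manifolds -/

section Manifold

variable (m : ℕ) (M : Type u) [TopologicalSpace M] [ChartedSpace (Cart m) M]

/-- Fields of alternating `k`-forms on the tangent spaces of `M`, with no regularity. -/
abbrev FormField (k : ℕ) : Type u := ∀ x : M, TangentSpace (𝓡 m) x [⋀^Fin k]→L[ℝ] ℝ

variable {m M}

/-- The differential `T_z ℝⁿ = ℝⁿ → T_{f(z)} M` of a map `f : ℝⁿ → M`. -/
def diffInto {n : ℕ} (f : Cart n → M) (z : Cart n) : Cart n →L[ℝ] TangentSpace (𝓡 m) (f z) :=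
  mfderiv (𝓡 n) (𝓡 m) f z

/-- The differential `T_x M → T ℝⁿ = ℝⁿ` of a map `f : M → ℝⁿ`. -/
def diffOutOf {n : ℕ} (f : M → Cart n) (x : M) : TangentSpace (𝓡 m) x →L[ℝ] Cart n :=
  mfderiv (𝓡 m) (𝓡 n) f x

/-- The pullback `f^* α` along a map `f : ℝⁿ → M`. -/
def FormField.pullback {n k : ℕ} (f : Cart n → M) (α : FormField m M k) :
    Cart n → Cart n [⋀^Fin k]→L[ℝ] ℝ :=
  fun z ↦ (α (f z)).compContinuousLinearMap (diffInto f z)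

/-- The expression of a field of forms in a chart `φ`, that is, its pullback along `φ⁻¹`. -/
def FormField.inChart {k : ℕ} (φ : OpenPartialHomeomorph M (Cart m)) (α : FormField m M k) :
    Cart m → Cart m [⋀^Fin k]→L[ℝ] ℝ :=
  α.pullback φ.symm

/-- The expression of a vector field in a chart `φ`. -/
def vectorInChart (φ : OpenPartialHomeomorph M (Cart m)) (X : ∀ x : M, TangentSpace (𝓡 m) x) :
    Cart m → Cart m :=
  fun z ↦ diffOutOf φ (φ.symm z) (X (φ.symm z))

variable (m M) in
/-- The smooth differential `k`-forms on `M`. -/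
def ManifoldForm [IsManifold (𝓡 m) ∞ M] (k : ℕ) : Submodule ℝ (FormField m M k) where
  carrier := {α | ∀ φ ∈ IsManifold.maximalAtlas (𝓡 m) ∞ M, ContDiffOn ℝ ∞ (α.inChart φ) φ.target}
  add_mem' := fun ha hb φ hφ ↦ (ha φ hφ).add (hb φ hφ)
  zero_mem' := fun _ _ ↦ contDiffOn_const (c := 0)
  smul_mem' := fun c _ ha φ hφ ↦ (ha φ hφ).const_smul c

/-- The exterior derivative, computed at `x` in the preferred chart at `x`. -/
def FormField.d {k : ℕ} (α : FormField m M k) : FormField m M (k + 1) :=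
  fun x ↦ (extDeriv (α.inChart (chartAt (Cart m) x))
      (chartAt (Cart m) x x)).compContinuousLinearMap
    (diffOutOf (chartAt (Cart m) x) x)

/-- The Lie derivative of a form `η` on `ℝᵐ` along the vector field `V`:
`(L_V η)(v₁, …, v_k) = (D_V η)(v₁, …, v_k) + ∑ i, η(v₁, …, DV(v_i), …, v_k)`,
i.e. the derivative at `t = 0` of the pullback of `η` along the flow of `V`. -/
def lieDerivCart {n k : ℕ} (V : Cart n → Cart n) (η : Cart n → Cart n [⋀^Fin k]→L[ℝ] ℝ) :
    Cart n → Cart n [⋀^Fin k]→L[ℝ] ℝ :=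
  fun z ↦ fderiv ℝ η z (V z) +
    (η z).fderivCompContinuousLinearMap (ContinuousLinearMap.id ℝ (Cart n)) (fderiv ℝ V z)

/-- The Lie derivative `L_X α`, computed at `x` in the preferred chart at `x`. -/
def lieDeriv {k : ℕ} (X : ∀ x : M, TangentSpace (𝓡 m) x) (α : FormField m M k) :
    FormField m M k :=
  fun x ↦ (lieDerivCart (vectorInChart (chartAt (Cart m) x) X) (α.inChart (chartAt (Cart m) x))
      (chartAt (Cart m) x x)).compContinuousLinearMap
    (diffOutOf (chartAt (Cart m) x) x)

/-- The condition `ι_X α = 0`. The contraction of a `0`-form is zero by convention. -/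
def ContractionEqZero (X : ∀ x : M, TangentSpace (𝓡 m) x) : {k : ℕ} → FormField m M k → Prop
  | 0, _ => True
  | k + 1, α => ∀ (x : M) (v : Fin k → TangentSpace (𝓡 m) x),
      α x (Fin.cons (α := fun _ ↦ TangentSpace (𝓡 m) x) (X x) v) = 0

end Manifold

/-! ### Singular foliations -/

section Foliation

variable {m : ℕ} {M : Type u} [TopologicalSpace M] [ChartedSpace (Cart m) M]

variable (m) in
/-- A `k`-dimensional connected manifold structure on `L ⊆ M` that makes `L` a weakly-embedded
submanifold: the manifold diffeology is the subspace diffeology, and the inclusion is an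
immersion. -/
structure WeaklyEmbedded (k : ℕ) (L : Set M) where
  [top : TopologicalSpace (Carrier L)]
  [charted : ChartedSpace (Cart k) (Carrier L)]
  [isManifold : IsManifold (𝓡 k) ∞ (Carrier L)]
  [t2 : T2Space (Carrier L)]
  [secondCountable : SecondCountableTopology (Carrier L)]
  [connected : ConnectedSpace (Carrier L)]
  diffeology_eq : manifoldDiffeology k (Carrier L) = subsetDiffeology m L
  immersion : Manifold.IsImmersion (𝓡 k) (𝓡 m) ∞ (Carrier.incl L)

/-- The image of the tangent space at `x ∈ L` of a weakly-embedded submanifold in `T_x M`. -/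
def WeaklyEmbedded.tangent {k : ℕ} {L : Set M} (S : WeaklyEmbedded m k L) (x : M)
    (hx : x ∈ L) : Set (TangentSpace (𝓡 m) x) :=
  letI := S.top
  letI := S.charted
  Set.range (mfderiv (𝓡 k) (𝓡 m) (Carrier.incl L) (⟨x, hx⟩ : Carrier L))

variable (m) in
/-- A Stefan singular foliation of the manifold `M`: a partition into connected weakly-embedded
submanifolds, the leaves (the classes of `rel`), such that about each `x` there is a diffeomorphism
`ψ : V → U × W` from an open subset of `M`, with `U ⊆ ℝᵏ` and `W ⊆ ℝ^(m-k)` open neighbourhoods of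
the origin and `k` the dimension of the leaf through `x`, such that `ψ x = (0, 0)` and
`ψ (L ∩ V) = U × ℓ` with some `ℓ ⊆ W`, for each leaf `L`. -/
structure SingularFoliation (M : Type u) [TopologicalSpace M] [ChartedSpace (Cart m) M] where
  /-- Lying in the same leaf. -/
  rel : Setoid M
  exists_chart : ∀ x : M, ∃ k : ℕ, Nonempty (WeaklyEmbedded m k {y | rel x y}) ∧
    ∃ (ψ : OpenPartialHomeomorph M (Cart k × Cart (m - k)))
      (U : Set (Cart k)) (W : Set (Cart (m - k))),
      ContMDiffOn (𝓡 m) 𝓘(ℝ, Cart k × Cart (m - k)) ∞ ψ ψ.source ∧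
      ContMDiffOn 𝓘(ℝ, Cart k × Cart (m - k)) (𝓡 m) ∞ ψ.symm ψ.target ∧
      IsOpen U ∧ 0 ∈ U ∧ IsOpen W ∧ 0 ∈ W ∧ ψ.target = U ×ˢ W ∧
      x ∈ ψ.source ∧ ψ x = (0, 0) ∧
      ∀ y : M, ∃ ℓ ⊆ W, ψ '' ({z | rel y z} ∩ ψ.source) = U ×ˢ ℓ

namespace SingularFoliation

variable (F : SingularFoliation m M)

/-- The leaf through `x`. -/
def leaf (x : M) : Set M := {y | F.rel x y}

/-- The tangent space at `x` of the leaf through `x`. (A subset has at most one structure of a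
weakly-embedded submanifold, so that the choice of the structure does not matter.) -/
def tangent (x : M) : Set (TangentSpace (𝓡 m) x) :=
  {v | ∃ (k : ℕ) (S : WeaklyEmbedded m k (F.leaf x)), v ∈ S.tangent x (F.rel.refl x)}

/-- Smooth vector fields on `M` tangent to the foliation. -/
def IsTangentField [IsManifold (𝓡 m) ∞ M] (X : ∀ x : M, TangentSpace (𝓡 m) x) : Prop :=
  ContMDiff (𝓡 m) (𝓡 m).tangent ∞ (fun x ↦ (⟨x, X x⟩ : TangentBundle (𝓡 m) M)) ∧
    ∀ x, X x ∈ F.tangent x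

/-- The leaf space `M/F`. -/
def LeafSpace : Type u := Quotient F.rel

/-- The quotient map `π : M → M/F`. -/
def proj (x : M) : F.LeafSpace := Quotient.mk F.rel x

/-- The quotient diffeology on the leaf space: the plots are the maps that lift locally, along the
quotient map, to smooth maps into `M`. -/
instance : DiffeologicalSpace F.LeafSpace :=
  DiffeologicalSpace.ofCorePlotsOn
    { isPlotOn := fun {n s} _ p ↦ ∀ r ∈ s, ∃ (V : Set (Cart n)) (q : Cart n → M),
        IsOpen V ∧ r ∈ V ∧ V ⊆ s ∧ ContMDiffOn (𝓡 n) (𝓡 m) ∞ q V ∧ ∀ z ∈ V, p z = F.proj (q z)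
      isPlotOn_congr := fun {n s} _ p p' h ↦ by
        constructor
        · intro H r hr
          obtain ⟨V, q, hV, hrV, hVs, hq, e⟩ := H r hr
          exact ⟨V, q, hV, hrV, hVs, hq, fun z hz ↦ (h (hVs hz)).symm.trans (e z hz)⟩
        · intro H r hr
          obtain ⟨V, q, hV, hrV, hVs, hq, e⟩ := H r hr
          exact ⟨V, q, hV, hrV, hVs, hq, fun z hz ↦ (h (hVs hz)).trans (e z hz)⟩
      isPlot_const := fun x r _ ↦ by
        obtain ⟨y, rfl⟩ := Quotient.exists_rep x
        exact ⟨Set.univ, fun _ ↦ y, isOpen_univ, trivial, subset_rfl, contMDiffOn_const,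
          fun _ _ ↦ rfl⟩
      isPlotOn_reparam := fun {n l s t _} ht p f h hp hf r hr ↦ by
        obtain ⟨V, q, hV, hrV, hVs, hq, e⟩ := hp (f r) (h hr)
        refine ⟨t ∩ f ⁻¹' V, q ∘ f, hf.continuousOn.isOpen_inter_preimage ht hV, ⟨hr, hrV⟩,
          Set.inter_subset_left, ?_, fun z hz ↦ e _ hz.2⟩
        exact hq.comp (hf.contMDiffOn.mono Set.inter_subset_left) fun z hz ↦ hz.2
      locality := fun {n s} hs p H r hr ↦ by
        obtain ⟨t, ht, hrt, H'⟩ := H r hr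
        obtain ⟨V, q, hV, hrV, hVs, hq, e⟩ := H' r hrt
        exact ⟨V ∩ s, q, hV.inter hs, ⟨hrV, hr⟩, Set.inter_subset_right,
          hq.mono Set.inter_subset_left, fun z hz ↦ e z hz.1⟩ }

theorem isPlot_proj_comp {n : ℕ} (q : Cart n → M) (hq : ContMDiff (𝓡 n) (𝓡 m) ∞ q) :
    Diffeology.IsPlot (F.proj ∘ q) :=
  fun _ _ ↦ ⟨Set.univ, q, isOpen_univ, trivial, subset_rfl, hq.contMDiffOn, fun _ _ ↦ rfl⟩

theorem inChart_differentiableAt [IsManifold (𝓡 m) ∞ M] {k : ℕ} {α : FormField m M k}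
    (hα : α ∈ ManifoldForm m M k) (x : M) :
    DifferentiableAt ℝ (α.inChart (chartAt (Cart m) x)) (chartAt (Cart m) x x) :=
  ((hα (chartAt (Cart m) x) (IsManifold.chart_mem_maximalAtlas x)).contDiffAt
    ((chartAt (Cart m) x).open_target.mem_nhds
      (mem_chart_target (Cart m) x))).differentiableAt (by simp)

theorem lieDeriv_add [IsManifold (𝓡 m) ∞ M] {k : ℕ} {α β : FormField m M k}
    (hα : α ∈ ManifoldForm m M k) (hβ : β ∈ ManifoldForm m M k)
    (X : ∀ x : M, TangentSpace (𝓡 m) x) :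
    lieDeriv X (α + β) = lieDeriv X α + lieDeriv X β := by
  funext x
  have h : (α + β).inChart (chartAt (Cart m) x) =
    α.inChart (chartAt (Cart m) x) + β.inChart (chartAt (Cart m) x) := rfl
  ext v
  simp only [lieDeriv, lieDerivCart, h, Pi.add_apply,
    fderiv_add (inChart_differentiableAt hα x) (inChart_differentiableAt hβ x),
    ContinuousAlternatingMap.compContinuousLinearMap_apply, ContinuousAlternatingMap.add_apply,
    ContinuousAlternatingMap.fderivCompContinuousLinearMap_apply, add_apply,
    Finset.sum_add_distrib]
  ring

theorem lieDeriv_smul [IsManifold (𝓡 m) ∞ M] {k : ℕ} {α : FormField m M k}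
    (c : ℝ) (X : ∀ x : M, TangentSpace (𝓡 m) x) :
    lieDeriv X (c • α) = c • lieDeriv X α := by
  funext x
  have h : (c • α).inChart (chartAt (Cart m) x) = c • α.inChart (chartAt (Cart m) x) := rfl
  have h' : fderiv ℝ (c • α.inChart (chartAt (Cart m) x)) (chartAt (Cart m) x x) =
    c • fderiv ℝ (α.inChart (chartAt (Cart m) x)) (chartAt (Cart m) x x) :=
    congrFun (fderiv_const_smul_field (𝕜 := ℝ) (f := α.inChart (chartAt (Cart m) x)) c) _
  ext v
  simp only [lieDeriv, lieDerivCart, h, Pi.smul_apply, h',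
    ContinuousAlternatingMap.compContinuousLinearMap_apply, ContinuousAlternatingMap.add_apply,
    ContinuousAlternatingMap.fderivCompContinuousLinearMap_apply, smul_apply,
    ContinuousAlternatingMap.smul_apply, ← Finset.smul_sum, smul_add]

/-- The basic `k`-forms: smooth forms `α` on `M` with `ι_X α = 0` and `L_X α = 0` for every vector
field `X` tangent to the foliation. -/
def basicForms [IsManifold (𝓡 m) ∞ M] (k : ℕ) : Submodule ℝ (FormField m M k) where
  carrier := {α | α ∈ ManifoldForm m M k ∧
    ∀ X, F.IsTangentField X → ContractionEqZero X α ∧ lieDeriv X α = 0}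
  add_mem' := by
    rintro α β ⟨ha, ha'⟩ ⟨hb, hb'⟩
    refine ⟨add_mem ha hb, fun X hX ↦ ⟨?_, ?_⟩⟩
    · cases k with
      | zero => trivial
      | succ k =>
        intro x v
        have h1 := (ha' X hX).1 x v
        have h2 := (hb' X hX).1 x v
        simp [h1, h2]
    · rw [lieDeriv_add ha hb, (ha' X hX).2, (hb' X hX).2, add_zero]
  zero_mem' := by
    refine ⟨zero_mem _, fun X hX ↦ ⟨?_, ?_⟩⟩
    · cases k with
      | zero => trivial
      | succ k => intro x v; rfl
    · simpa using lieDeriv_smul (α := (0 : FormField m M k)) 0 X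
  smul_mem' := by
    rintro c α ⟨ha, ha'⟩
    refine ⟨(ManifoldForm m M k).smul_mem c ha, fun X hX ↦ ⟨?_, ?_⟩⟩
    · cases k with
      | zero => trivial
      | succ k =>
        intro x v
        have h1 := (ha' X hX).1 x v
        simp [h1]
    · rw [lieDeriv_smul, (ha' X hX).2, smul_zero]

/-- The form `η` on `M` is the pullback `π^* α` of the diffeological form `α` on the leaf space:
`q^* η = α (π ∘ q)` for every plot `q` of `M`. This determines `η`. -/
def IsPullbackByProj {k : ℕ} (α : DiffeoForm F.LeafSpace k) (η : FormField m M k) : Prop :=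
  ∀ (n : ℕ) (q : Cart n → M) (hq : ContMDiff (𝓡 n) (𝓡 m) ∞ q),
    η.pullback q = α.1 n ⟨F.proj ∘ q, F.isPlot_proj_comp q hq⟩

/-- The quotient map induces an isomorphism of complexes `π^* : Ω^•(M/F) → Ω_b^•(M, F)`: in each
degree `π^*` is a linear isomorphism from the diffeological forms on the leaf space onto the basic
forms, and it commutes with the exterior derivatives. -/
def PullbackIsIso [IsManifold (𝓡 m) ∞ M] : Prop :=
  ∃ Φ : ∀ k : ℕ, DiffeoForm F.LeafSpace k ≃ₗ[ℝ] F.basicForms k,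
    (∀ k α, F.IsPullbackByProj α (Φ k α : FormField m M k)) ∧
    ∀ k α, (Φ (k + 1) (DiffeoForm.d α) : FormField m M (k + 1)) = (Φ k α : FormField m M k).d

end SingularFoliation

/-! ### Molino transverse equivalence -/

/-- A surjective submersion with connected fibers. -/
def IsConnectedSubmersion {m n : ℕ} {M : Type u} [TopologicalSpace M] [ChartedSpace (Cart m) M]
    {N : Type v} [TopologicalSpace N] [ChartedSpace (Cart n) N] (p : M → N) : Prop :=
  Function.Surjective p ∧ Manifold.IsSubmersion (𝓡 m) (𝓡 n) ∞ p ∧ ∀ y, IsConnected (p ⁻¹' {y})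

/-- `F` is the pullback `p⁻¹ G`: the leaves of `F` are the sets `p⁻¹ L`, with `L` a leaf of `G`. -/
def SingularFoliation.IsPullback {m n : ℕ} {M : Type u} [TopologicalSpace M]
    [ChartedSpace (Cart m) M] {N : Type v} [TopologicalSpace N] [ChartedSpace (Cart n) N]
    (p : M → N) (G : SingularFoliation n N) (F : SingularFoliation m M) : Prop :=
  {L : Set M | ∃ x, L = F.leaf x} = {L : Set M | ∃ y, L = p ⁻¹' G.leaf y}

/-- Molino transverse equivalence of singular foliations. -/
def MolinoEquivalent {n₀ n₁ : ℕ}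
    {N₀ : Type u} [TopologicalSpace N₀] [ChartedSpace (Cart n₀) N₀]
    {N₁ : Type v} [TopologicalSpace N₁] [ChartedSpace (Cart n₁) N₁]
    (F₀ : SingularFoliation n₀ N₀) (F₁ : SingularFoliation n₁ N₁) : Prop :=
  ∃ (m : ℕ) (M : Type w) (_ : TopologicalSpace M) (_ : ChartedSpace (Cart m) M)
    (_ : IsManifold (𝓡 m) ∞ M) (_ : T2Space M) (_ : SecondCountableTopology M)
    (F : SingularFoliation m M) (p₀ : M → N₀) (p₁ : M → N₁),
    IsConnectedSubmersion (m := m) (n := n₀) p₀ ∧ IsConnectedSubmersion (m := m) (n := n₁) p₁ ∧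
    SingularFoliation.IsPullback p₀ F₀ F ∧ SingularFoliation.IsPullback p₁ F₁ F

end Foliation

end

end SingFol

namespace SingFol

noncomputable section

/-! ### Calculus on Cartesian spaces -/

/-! Let `M`, with `p₀` and `p₁`, be the apex of the equivalence. Sending the leaf of `p₀ x` to the
leaf of `p₁ x` is a diffeomorphism of leaf spaces, because plots lift locally through submersions
(`IsSpan.dSmooth_leafMap`); so diffeological forms on the two leaf spaces correspond. Basic forms
correspond through the relation p₀^*η₀ = p₁^*η₁. The point is that p₁^*η₁ descends along `p₀` when
η₁ is basic. A `p₀`-fiber lies over a single leaf of `F₁`, so p₁^*η₁ and its exterior derivative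
vanish on vertical vectors. Hence p₁^*η₁ factors through dp₀ and is locally constant along the
fibers, which are connected (`IsSpan.exists_pullbacksAgree`). The descended form is basic because
basicness is pointwise: η is basic iff it is smooth and both η and dη vanish on tangent vectors of
leaves (`SingularFoliation.mem_basicForms_iff`). This rests on Cartan's formula and on extending
tangent vectors to tangent fields in a foliated chart. The two correspondences intertwine the maps
π_i^*, as one sees on plots lifted to `M` (`IsSpan.isPullbackByProj`). Compatibility with d follows
because pullbacks are determined by their values on plots. Plots here are defined on all of ℝⁿ, so
local constructions are precomposed with a smooth map `b` into a small neighbourhood that is the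
identity near the given point. -/

theorem exists_smooth_retract {E : Type*} [NormedAddCommGroup E] [NormedSpace ℝ E]
    [HasContDiffBump E] {V : Set E} {z : E} (hV : V ∈ 𝓝 z) :
    ∃ b : E → E, ContDiff ℝ ∞ b ∧ (∀ t, b t ∈ V) ∧ b =ᶠ[𝓝 z] id := by
  obtain ⟨ε, hε, hεV⟩ := Metric.mem_nhds_iff.1 hV
  -- The map scales t - z by χ: it is the identity where χ = 1, and it is constantly z outside the
  -- ε-ball.
  let χ : ContDiffBump z := ⟨ε / 2, ε, by positivity, by linarith⟩
  refine ⟨fun t ↦ z + χ t • (t - z), contDiff_const.add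
    (χ.contDiff.smul (contDiff_id.sub contDiff_const)), fun t ↦ hεV ?_, ?_⟩
  · rw [Metric.mem_ball, dist_eq_norm, add_sub_cancel_left, norm_smul, Real.norm_of_nonneg χ.nonneg]
    by_cases ht : t ∈ Metric.ball z ε
    · refine (mul_le_of_le_one_left (norm_nonneg _) χ.le_one).trans_lt ?_
      rwa [← dist_eq_norm]
    · have h0 : χ t = 0 := χ.zero_of_le_dist (by simpa using ht)
      rw [h0, zero_mul]
      exact hε
  · filter_upwards [χ.eventuallyEq_one] with t ht
    simp only [Pi.one_apply] at ht
    simp [ht]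

/-- Swapping slots `0` and `i` only changes the sign. -/
theorem alternating_eq_zero_of_cons {k : ℕ} {E : Type*} [AddCommGroup E] [Module ℝ E]
    [TopologicalSpace E] {η : E [⋀^Fin (k + 1)]→L[ℝ] ℝ} {v : E}
    (h : ∀ w : Fin k → E, η (Fin.cons v w) = 0) {w : Fin (k + 1) → E} {i : Fin (k + 1)}
    (hi : w i = v) : η w = 0 := by
  by_cases h0 : i = 0
  · subst h0
    rw [← Fin.cons_self_tail w, hi]
    exact h _
  · have h1 := η.toAlternatingMap.map_swap w (Ne.symm h0)
    have h2 := h (Fin.tail (w ∘ Equiv.swap 0 i))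
    have h3 : (w ∘ Equiv.swap 0 i) 0 = v := by simp [hi]
    rw [← h3, Fin.cons_self_tail] at h2
    have h4 : η w = - η (w ∘ Equiv.swap 0 i) := by
      simpa using (neg_eq_iff_eq_neg.2 h1).symm
    rw [h4, h2, neg_zero]

/-- Moving `v` from the front into slot `j` crosses `j` arguments. This matches the signs in the sum
defining the exterior derivative. -/
theorem ContinuousAlternatingMap.neg_one_pow_smul_removeNth_cons {k : ℕ} {E : Type*}
    [NormedAddCommGroup E] [NormedSpace ℝ E] (η : E [⋀^Fin k]→L[ℝ] ℝ) (v : E) (w : Fin k → E)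
    (j : Fin k) :
    (-1 : ℝ) ^ (j : ℕ) * η (j.succ.removeNth (Fin.cons (α := fun _ ↦ E) v w)) =
      η (Function.update w j v) := by
  cases k with
  | zero => exact j.elim0
  | succ k =>
    have h1 : Function.update w j v = j.insertNth (α := fun _ ↦ E) v (j.removeNth w) := by
      simp
    have h2 : j.succ.removeNth (Fin.cons (α := fun _ ↦ E) v w) =
        Matrix.vecCons v (j.removeNth w) := by
      ext i : 1
      refine Fin.cases ?_ (fun i ↦ ?_) i <;> simp [Fin.removeNth]
    rw [h1, h2, η.map_insertNth, zsmul_eq_mul]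
    push_cast
    rfl

/-- Cartan's formula for a form annihilated by the vector field. -/
theorem lieDerivCart_eq_extDeriv {n k : ℕ} {V : Cart n → Cart n}
    {η : Cart n → Cart n [⋀^Fin k]→L[ℝ] ℝ} {z : Cart n} (hV : DifferentiableAt ℝ V z)
    (hη : DifferentiableAt ℝ η z)
    (h : ∀ᶠ y in 𝓝 z, ∀ (w : Fin k → Cart n) (i : Fin k), w i = V y → η y w = 0)
    (w : Fin k → Cart n) :
    lieDerivCart V η z w = extDeriv η z (Fin.cons (α := fun _ ↦ Cart n) (V z) w) := by
  -- Differentiate η(…, V, …) = 0, with V in slot `j` and the other arguments fixed, in the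
  -- direction `w j`.
  have key : ∀ j : Fin k, η z (Function.update w j (fderiv ℝ V z (w j))) =
      -(fderiv ℝ η z (w j) (Function.update w j (V z))) := by
    intro j
    let U : Fin k → Cart n → Cart n :=
      fun i y ↦ Function.update w j (V y) i
    let U' : Fin k → Cart n →L[ℝ] Cart n :=
      fun i ↦ Function.update (fun _ ↦ (0 : Cart n →L[ℝ] Cart n)) j (fderiv ℝ V z) i
    have hU : ∀ i, HasFDerivAt (U i) (U' i) z := by
      intro i
      by_cases hi : i = j
      · subst hi
        simpa [U, U'] using hV.hasFDerivAt
      · simpa [U, U', hi] using hasFDerivAt_const (w i) z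
    have h2 : (fun y ↦ η y fun i ↦ U i y) =ᶠ[𝓝 z] fun _ ↦ 0 := by
      filter_upwards [h] with y hy
      exact hy _ j (by simp [U])
    have h1 := fderiv_continuousAlternatingMap_apply_apply hη
      (fun i ↦ (hU i).differentiableAt) (w j)
    rw [h2.fderiv_eq, Finset.sum_eq_single j ?_ (by simp), (hU j).fderiv] at h1
    · have h3 : (fun i ↦ U i z) = Function.update w j (V z) := rfl
      simp only [h3, U', Function.update_self, Function.update_idem, fderiv_fun_const,
        Pi.zero_apply, zero_apply] at h1
      linarith
    · intro i _ hi
      refine (η z).map_coord_zero i ?_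
      rw [(hU i).fderiv]
      simp [U', hi]
  -- Term 0 is the derivative of η along V. In term j + 1 the extra sign cancels the one in `key`,
  -- leaving the term of the Lie derivative with DV in slot `j`.
  rw [extDeriv_apply hη, Fin.sum_univ_succ]
  simp only [Fin.val_zero, pow_zero, one_smul, Fin.cons_zero, Fin.cons_succ, lieDerivCart,
    ContinuousAlternatingMap.add_apply,
    fderiv_continuousAlternatingMap_apply_const_apply hη,
    ContinuousAlternatingMap.fderivCompContinuousLinearMap_apply]
  congr 1
  refine Finset.sum_congr rfl fun j _ ↦ ?_
  have h4 : (fun i ↦ (Function.update (fun _ ↦ ContinuousLinearMap.id ℝ (Cart n)) j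
      (fderiv ℝ V z) i) (w i)) = Function.update w j (fderiv ℝ V z (w j)) := by
    ext i : 1
    by_cases hi : i = j
    · subst hi; simp
    · simp [hi]
  rw [h4, key, Fin.val_succ, pow_succ, ← ContinuousAlternatingMap.neg_one_pow_smul_removeNth_cons]
  simp

/-- A form annihilated, together with its exterior derivative, by a constant vector field is
constant along that field. -/
theorem eq_of_contraction_eq_zero {n k : ℕ} {η : Cart n → Cart n [⋀^Fin k]→L[ℝ] ℝ}
    {s : Set (Cart n)} (hs : Convex ℝ s) (hso : IsOpen s) (hη : DifferentiableOn ℝ η s)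
    {x y : Cart n} (hx : x ∈ s) (hy : y ∈ s)
    (h : ∀ z ∈ s, ∀ (w : Fin k → Cart n) (i : Fin k), w i = y - x → η z w = 0)
    (h' : ∀ z ∈ s, ∀ (w : Fin (k + 1) → Cart n) (i : Fin (k + 1)), w i = y - x →
      extDeriv η z w = 0) : η y = η x := by
  -- For the constant field V = y - x one has DV = 0, so Cartan's formula reads D_V η = ι_V dη.
  have hder : ∀ z ∈ s, fderiv ℝ η z (y - x) = 0 := by
    intro z hz
    have hd := hη.differentiableAt (hso.mem_nhds hz)
    ext w
    have h1 := lieDerivCart_eq_extDeriv (V := fun _ ↦ y - x) (differentiableAt_const _) hd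
      (Filter.eventually_of_mem (hso.mem_nhds hz) h) w
    rw [h' z hz _ 0 rfl] at h1
    simpa [lieDerivCart] using h1
  have hseg : ∀ t ∈ Set.Icc (0 : ℝ) 1, x + t • (y - x) ∈ s := by
    intro t ht
    exact hs.add_smul_sub_mem hx hy ht
  have h1 : ∀ t ∈ Set.Icc (0 : ℝ) 1, HasDerivAt (fun t : ℝ ↦ η (x + t • (y - x))) 0 t := by
    intro t ht
    have h2 : HasDerivAt (fun t : ℝ ↦ x + t • (y - x)) (y - x) t := by
      simpa using ((hasDerivAt_id t).smul_const (y - x)).const_add x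
    have h3 := (hη.differentiableAt (hso.mem_nhds (hseg t ht))).hasFDerivAt.comp_hasDerivAt t h2
    rwa [hder _ (hseg t ht)] at h3
  have h2 := constant_of_has_deriv_right_zero (f := fun t : ℝ ↦ η (x + t • (y - x))) (a := 0)
    (b := 1) (fun t ht ↦ (h1 t ht).continuousAt.continuousWithinAt)
    (fun t ht ↦ (h1 t (Set.Ico_subset_Icc_self ht)).hasDerivWithinAt) 1 (by simp)
  simpa using h2

/-! ### Differential forms on manifolds and their pullbacks along plots -/

section Plots

variable {m : ℕ} {M : Type u} [TopologicalSpace M] [ChartedSpace (Cart m) M]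

theorem ContMDiffOn.comp_contDiff {n l : ℕ} {q : Cart n → M} {V : Set (Cart n)}
    (hq : ContMDiffOn (𝓡 n) (𝓡 m) ∞ q V) {b : Cart l → Cart n} (hb : ContDiff ℝ ∞ b)
    (hbV : ∀ t, b t ∈ V) : ContMDiff (𝓡 l) (𝓡 m) ∞ (q ∘ b) :=
  contMDiffOn_univ.1 (hq.comp hb.contMDiff.contMDiffOn fun t _ ↦ hbV t)

theorem FormField.pullback_congr {n k : ℕ} (α : FormField m M k) {q q' : Cart n → M} {z : Cart n}
    (h : q =ᶠ[𝓝 z] q') : α.pullback q z = α.pullback q' z := by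
  -- Tangent spaces at points that are only propositionally equal are compared in the model space
  -- `Cart m`; the same device recurs below.
  have key : ∀ (y y' : M) (L L' : Cart n →L[ℝ] Cart m), y = y' → L = L' →
      (show Cart m [⋀^Fin k]→L[ℝ] ℝ from α y).compContinuousLinearMap L =
        (show Cart m [⋀^Fin k]→L[ℝ] ℝ from α y').compContinuousLinearMap L' := by
    rintro y _ L _ rfl rfl
    rfl
  exact key _ _ _ _ h.self_of_nhds h.mfderiv_eq

theorem FormField.pullback_comp {n l k : ℕ} (α : FormField m M k) {q : Cart n → M}
    {f : Cart l → Cart n} {z : Cart l} (hq : MDifferentiableAt (𝓡 n) (𝓡 m) q (f z))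
    (hf : DifferentiableAt ℝ f z) :
    α.pullback (q ∘ f) z = (α.pullback q (f z)).compContinuousLinearMap (fderiv ℝ f z) := by
  have h : diffInto (q ∘ f) z = (diffInto (m := m) q (f z)).comp (fderiv ℝ f z) := by
    rw [diffInto, mfderiv_comp z hq hf.mdifferentiableAt, mfderiv_eq_fderiv]
    rfl
  ext v
  simp only [FormField.pullback, h]
  rfl

theorem FormField.pullback_comp_eq_of_eventuallyEq_id {n k : ℕ} (α : FormField m M k)
    (q : Cart n → M) {b : Cart n → Cart n} {z : Cart n} (hb : b =ᶠ[𝓝 z] id) :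
    α.pullback (q ∘ b) z = α.pullback q z :=
  α.pullback_congr (hb.fun_comp q)

/-- Values on tuples of basis vectors embed the alternating forms linearly in a finite product of
copies of ℝ; a linear left inverse recovers `f` from its smooth components. -/
theorem contDiffAt_alternating_of_apply {l n k : ℕ} {f : Cart l → Cart n [⋀^Fin k]→L[ℝ] ℝ}
    {z : Cart l} (h : ∀ w, ContDiffAt ℝ ∞ (fun y ↦ f y w) z) : ContDiffAt ℝ ∞ f z := by
  let e := (EuclideanSpace.basisFun (Fin n) ℝ).toBasis
  let J : (Cart n [⋀^Fin k]→L[ℝ] ℝ) →ₗ[ℝ] ((Fin k → Fin n) → ℝ) :=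
    { toFun := fun A σ ↦ A fun i ↦ e (σ i)
      map_add' := fun _ _ ↦ rfl
      map_smul' := fun _ _ ↦ rfl }
  have hJ : LinearMap.ker J = ⊥ := by
    refine LinearMap.ker_eq_bot.2 fun A B hAB ↦ ?_
    apply ContinuousAlternatingMap.toAlternatingMap_injective
    exact e.ext_alternating fun σ _ ↦ congrFun hAB σ
  obtain ⟨g, hg⟩ := J.exists_leftInverse_of_injective hJ
  have hf : f = fun y ↦ LinearMap.toContinuousLinearMap g (fun σ ↦ f y fun i ↦ e (σ i)) :=
    funext fun y ↦ (LinearMap.congr_fun hg (f y)).symm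
  rw [hf]
  exact (LinearMap.toContinuousLinearMap g).contDiff.contDiffAt.comp z
    (contDiffAt_pi.2 fun σ ↦ h _)

theorem contDiffAt_compContinuousLinearMap_fderiv {n l k : ℕ}
    {η : Cart n → Cart n [⋀^Fin k]→L[ℝ] ℝ} {f : Cart l → Cart n} {z : Cart l}
    (hη : ContDiffAt ℝ ∞ η (f z)) (hf : ContDiffAt ℝ ∞ f z) :
    ContDiffAt ℝ ∞ (fun y ↦ (η (f y)).compContinuousLinearMap (fderiv ℝ f y)) z := by
  refine contDiffAt_alternating_of_apply fun w ↦ ?_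
  have h1 : ContDiffAt ℝ ∞ (fun y ↦
      ContinuousAlternatingMap.toContinuousMultilinearMapCLM ℝ (η (f y))) z :=
    (ContinuousLinearMap.contDiff _).contDiffAt.comp z (hη.comp z hf)
  have h2 : ContDiffAt ℝ ∞ (fderiv ℝ f) z := hf.fderiv_right (m := ∞) (by simp)
  have h3 := (ContinuousMultilinearMap.analyticAt_uncurry_compContinuousLinearMap (𝕜 := ℝ)
    (q := (fun _ : Fin k ↦ fderiv ℝ f z,
      ContinuousAlternatingMap.toContinuousMultilinearMapCLM ℝ (η (f z))))).contDiffAt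
      (n := ∞)
  have h4 := h3.comp z (f := fun y ↦ (fun _ : Fin k ↦ fderiv ℝ f y,
      ContinuousAlternatingMap.toContinuousMultilinearMapCLM ℝ (η (f y))))
      ((contDiffAt_pi.2 fun _ ↦ h2).prodMk h1)
  exact (ContinuousMultilinearMap.apply ℝ (fun _ : Fin k ↦ Cart l) ℝ w).contDiff.contDiffAt.comp z
    h4

theorem exists_plot {φ : OpenPartialHomeomorph M (Cart m)}
    (hφ : φ ∈ IsManifold.maximalAtlas (𝓡 m) ∞ M) {z : Cart m} (hz : z ∈ φ.target) :
    ∃ q : Cart m → M, ContMDiff (𝓡 m) (𝓡 m) ∞ q ∧ q =ᶠ[𝓝 z] φ.symm := by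
  obtain ⟨b, hb, hbV, hbz⟩ := exists_smooth_retract (φ.open_target.mem_nhds hz)
  exact ⟨φ.symm ∘ b, ContMDiffOn.comp_contDiff
    (contMDiffOn_symm_of_mem_maximalAtlas hφ) hb hbV, hbz.fun_comp _⟩

theorem mdifferentiable_of_mem_maximalAtlas {φ : OpenPartialHomeomorph M (Cart m)}
    (hφ : φ ∈ IsManifold.maximalAtlas (𝓡 m) ∞ M) : φ.MDifferentiable (𝓡 m) (𝓡 m) :=
  ⟨(contMDiffOn_of_mem_maximalAtlas hφ).mdifferentiableOn (by simp),
    (contMDiffOn_symm_of_mem_maximalAtlas hφ).mdifferentiableOn (by simp)⟩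

/-- The expression of the pullback of a form along a plot in terms of a chart. -/
theorem FormField.pullback_eventuallyEq_inChart {n k : ℕ} (α : FormField m M k) {q : Cart n → M}
    (hq : ContMDiff (𝓡 n) (𝓡 m) ∞ q) {φ : OpenPartialHomeomorph M (Cart m)}
    (hφ : φ ∈ IsManifold.maximalAtlas (𝓡 m) ∞ M) {z : Cart n} (hz : q z ∈ φ.source) :
    ContDiffAt ℝ ∞ (φ ∘ q) z ∧ α.pullback q =ᶠ[𝓝 z] fun y ↦
      (α.inChart φ (φ (q y))).compContinuousLinearMap (fderiv ℝ (φ ∘ q) y) := by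
  have hev : ∀ᶠ y in 𝓝 z, q y ∈ φ.source :=
    hq.continuous.continuousAt.eventually (φ.open_source.mem_nhds hz)
  have hsm : ∀ y, q y ∈ φ.source → ContDiffAt ℝ ∞ (φ ∘ q) y := fun y hy ↦
    ((contMDiffAt_of_mem_maximalAtlas hφ hy).comp y hq.contMDiffAt).contDiffAt
  refine ⟨hsm z hz, ?_⟩
  filter_upwards [hev.eventually_nhds] with y hy
  rw [α.pullback_congr (q' := φ.symm ∘ (φ ∘ q)), pullback_comp]
  · rfl
  · exact (contMDiffAt_symm_of_mem_maximalAtlas hφ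
      (φ.map_source hy.self_of_nhds)).mdifferentiableAt (by simp)
  · exact (hsm y hy.self_of_nhds).differentiableAt (by simp)
  · filter_upwards [hy] with t ht
    exact (φ.left_inv ht).symm

variable [IsManifold (𝓡 m) ∞ M]

variable (m) in
theorem exists_plot_surjective (x : M) : ∃ (q : Cart m → M) (z : Cart m),
    ContMDiff (𝓡 m) (𝓡 m) ∞ q ∧ q z = x ∧ Function.Surjective (diffInto (m := m) q z) := by
  obtain ⟨q, hq, he⟩ := exists_plot (IsManifold.chart_mem_maximalAtlas (I := 𝓡 m) (n := ∞) x)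
    (mem_chart_target (Cart m) x)
  refine ⟨q, _, hq,
    he.self_of_nhds.trans ((chartAt (Cart m) x).left_inv (mem_chart_source _ x)), ?_⟩
  have h := (mdifferentiable_chart (I := 𝓡 m) x).symm.mfderiv_surjective
    (mem_chart_target (Cart m) x)
  have h2 : diffInto (m := m) q (chartAt (Cart m) x x) =
    mfderiv (𝓡 m) (𝓡 m) (chartAt (Cart m) x).symm (chartAt (Cart m) x x) := he.mfderiv_eq
  rw [h2]
  exact h

theorem FormField.ext_of_pullback {k : ℕ} {α β : FormField m M k}
    (h : ∀ q : Cart m → M, ContMDiff (𝓡 m) (𝓡 m) ∞ q → α.pullback q = β.pullback q) : α = β := by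
  funext x
  obtain ⟨q, z, hq, rfl, hs⟩ := exists_plot_surjective m x
  ext v
  choose w hw using fun i ↦ hs (v i)
  have h1 := congrArg (fun A ↦ A w) (congrFun (h q hq) z)
  have h2 : v = fun i ↦ diffInto (m := m) q z (w i) := funext fun i ↦ (hw i).symm
  rw [h2]
  exact h1

/-- A plot is locally a smooth map into a chart, and an inverse chart is locally a plot. Smoothness
thus becomes a condition that can be checked after lifting plots. -/
theorem mem_manifoldForm_iff {k : ℕ} {α : FormField m M k} :
    α ∈ ManifoldForm m M k ↔ ∀ (n : ℕ) (q : Cart n → M), ContMDiff (𝓡 n) (𝓡 m) ∞ q →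
      ContDiff ℝ ∞ (α.pullback q) := by
  constructor
  · intro h n q hq
    rw [contDiff_iff_contDiffAt]
    intro z
    have hφ := IsManifold.chart_mem_maximalAtlas (I := 𝓡 m) (n := ∞) (q z)
    have hz := mem_chart_source (Cart m) (q z)
    obtain ⟨h1, h2⟩ := α.pullback_eventuallyEq_inChart hq hφ hz
    refine (contDiffAt_compContinuousLinearMap_fderiv ?_ h1).congr_of_eventuallyEq h2
    exact (h _ hφ).contDiffAt
      ((chartAt (Cart m) (q z)).open_target.mem_nhds (mem_chart_target (Cart m) (q z)))
  · intro h φ hφ z hz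
    obtain ⟨q, hq, he⟩ := exists_plot hφ hz
    refine ((h m q hq).contDiffAt.congr_of_eventuallyEq ?_).contDiffWithinAt
    filter_upwards [he.eventually_nhds] with y hy
    exact (α.pullback_congr hy).symm

/-- Naturality of the exterior derivative on Cartesian spaces, applied to `q` read in the preferred
chart at `q z`. -/
theorem FormField.pullback_d {n k : ℕ} {α : FormField m M k} (hα : α ∈ ManifoldForm m M k)
    {q : Cart n → M} (hq : ContMDiff (𝓡 n) (𝓡 m) ∞ q) :
    α.d.pullback q = extDeriv (α.pullback q) := by
  funext z
  have hφ := IsManifold.chart_mem_maximalAtlas (I := 𝓡 m) (n := ∞) (q z)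
  have hz := mem_chart_source (Cart m) (q z)
  obtain ⟨h1, h2⟩ := α.pullback_eventuallyEq_inChart hq hφ hz
  have h3 := extDeriv_pullback (r := ∞) (f := chartAt (Cart m) (q z) ∘ q) (x := z)
    (SingularFoliation.inChart_differentiableAt hα (q z)) h1
    (by simpa using (WithTop.coe_le_coe.2 le_top : ((2 : ℕ∞) : WithTop ℕ∞) ≤ ∞))
  rw [h2.extDeriv_eq]
  refine Eq.trans ?_ h3.symm
  have h4 : fderiv ℝ (chartAt (Cart m) (q z) ∘ q) z =
      (diffOutOf (m := m) (chartAt (Cart m) (q z)) (q z)).comp (diffInto q z) := by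
    rw [← mfderiv_eq_fderiv]
    exact mfderiv_comp z
      ((contMDiffAt_of_mem_maximalAtlas hφ hz).mdifferentiableAt (by simp))
      (hq.mdifferentiableAt (by simp))
  rw [h4]
  rfl

end Plots

/-! ### Tangent vectors of singular foliations -/

section Tangent

variable {m : ℕ} {M : Type u} [TopologicalSpace M] [ChartedSpace (Cart m) M]

/-- Weak embeddedness enters here: a plot of `M` with values in `L` is smooth into the manifold `L`,
so the chain rule applies to the inclusion. -/
theorem WeaklyEmbedded.diffInto_mem_tangent {k : ℕ} {L : Set M} (S : WeaklyEmbedded m k L)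
    [IsManifold (𝓡 m) ∞ M] {n : ℕ} {c : Cart n → M} (hc : ContMDiff (𝓡 n) (𝓡 m) ∞ c)
    (hL : ∀ t, c t ∈ L) (z e : Cart n) : diffInto c z e ∈ S.tangent (c z) (hL z) := by
  let _ := S.top
  let _ := S.charted
  have _ := S.isManifold
  let c' : Cart n → Carrier L := fun t ↦ ⟨c t, hL t⟩
  have h1 : @Diffeology.IsPlot _ (subsetDiffeology m L) n c' := hc.contMDiffOn
  rw [← S.diffeology_eq] at h1
  have h2 : ContMDiff (𝓡 n) (𝓡 k) ∞ c' := contMDiffOn_univ.1 h1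
  refine ⟨mfderiv (𝓡 n) (𝓡 k) c' z e, ?_⟩
  have h3 : mfderiv (𝓡 n) (𝓡 m) (Carrier.incl L ∘ c') z =
      (mfderiv (𝓡 k) (𝓡 m) (Carrier.incl L) (c' z)).comp (mfderiv (𝓡 n) (𝓡 k) c' z) :=
    mfderiv_comp z (S.immersion.contMDiff.mdifferentiableAt (by simp))
      (h2.mdifferentiableAt (by simp))
  exact (congrArg (fun A : Cart n →L[ℝ] Cart m ↦ A e) h3).symm

theorem WeaklyEmbedded.exists_plot_of_mem_tangent {k : ℕ} {L : Set M} (S : WeaklyEmbedded m k L)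
    [IsManifold (𝓡 m) ∞ M] {x : M} {hx : x ∈ L} {v : TangentSpace (𝓡 m) x}
    (hv : v ∈ S.tangent x hx) : ∃ (c : Cart k → M) (z e : Cart k), ContMDiff (𝓡 k) (𝓡 m) ∞ c ∧
      (∀ t, c t ∈ L) ∧ c z = x ∧ (diffInto (m := m) c z e : Cart m) = v := by
  let _ := S.top
  let _ := S.charted
  have _ := S.isManifold
  obtain ⟨w, rfl⟩ := hv
  obtain ⟨q, z, hq, hz, hs⟩ := exists_plot_surjective (M := Carrier L) k ⟨x, hx⟩
  obtain ⟨e, he⟩ := hs (show Cart k from w)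
  refine ⟨Carrier.incl L ∘ q, z, e, S.immersion.contMDiff.comp hq, fun t ↦ (q t).2,
    congrArg (Carrier.incl L) hz, ?_⟩
  have h3 : diffInto (m := m) (Carrier.incl L ∘ q) z =
      (mfderiv (𝓡 k) (𝓡 m) (Carrier.incl L) (q z)).comp (diffInto (m := k) q z) :=
    mfderiv_comp z (S.immersion.contMDiff.mdifferentiableAt (by simp))
      (hq.mdifferentiableAt (by simp))
  rw [h3]
  have h4 : ∀ y y' : Carrier L, y = y' → ∀ a : Cart k,
      (mfderiv (𝓡 k) (𝓡 m) (Carrier.incl L) y a : Cart m) =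
        mfderiv (𝓡 k) (𝓡 m) (Carrier.incl L) y' a := by
    rintro y _ rfl a
    rfl
  exact (congrArg (mfderiv (𝓡 k) (𝓡 m) (Carrier.incl L) (q z)) he).trans (h4 _ _ hz _)

/-! ### Foliated charts and extension of tangent vectors -/

namespace SingularFoliation

variable (F : SingularFoliation m M)

/-- A chart with values in `U × W` in which every leaf is of the form `U × ℓ`. -/
structure IsFoliatedChart {k : ℕ} (ψ : OpenPartialHomeomorph M (Cart k × Cart (m - k)))
    (U : Set (Cart k)) (W : Set (Cart (m - k))) : Prop where
  contMDiffOn : ContMDiffOn (𝓡 m) 𝓘(ℝ, Cart k × Cart (m - k)) ∞ ψ ψ.source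
  contMDiffOn_symm : ContMDiffOn 𝓘(ℝ, Cart k × Cart (m - k)) (𝓡 m) ∞ ψ.symm ψ.target
  isOpen : IsOpen U
  target_eq : ψ.target = U ×ˢ W
  image_leaf : ∀ y : M, ∃ ℓ ⊆ W, ψ '' ({z | F.rel y z} ∩ ψ.source) = U ×ˢ ℓ

namespace IsFoliatedChart

variable {F} {k : ℕ} {ψ : OpenPartialHomeomorph M (Cart k × Cart (m - k))}
  {U : Set (Cart k)} {W : Set (Cart (m - k))} (h : F.IsFoliatedChart ψ U W)
include h

theorem mdifferentiable : ψ.MDifferentiable (𝓡 m) 𝓘(ℝ, Cart k × Cart (m - k)) :=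
  ⟨h.contMDiffOn.mdifferentiableOn (by simp), h.contMDiffOn_symm.mdifferentiableOn (by simp)⟩

/-- The leaf of `x` has image U × ℓ, so it contains the whole plaque through `x`. -/
theorem rel_symm {x : M} (hx : x ∈ ψ.source) {u : Cart k} (hu : u ∈ U) :
    F.rel x (ψ.symm (u, (ψ x).2)) := by
  obtain ⟨ℓ, -, hℓ⟩ := h.image_leaf x
  have h1 : ψ x ∈ U ×ˢ ℓ := hℓ ▸ ⟨x, ⟨F.rel.refl x, hx⟩, rfl⟩
  have h2 : (u, (ψ x).2) ∈ U ×ˢ ℓ := ⟨hu, h1.2⟩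
  rw [← hℓ] at h2
  obtain ⟨y, ⟨hy, hys⟩, hyu⟩ := h2
  rw [← hyu, ψ.left_inv hys]
  exact hy

/-- The vectors tangent to the first factor in a foliated chart. -/
def horizontal (ψ : OpenPartialHomeomorph M (Cart k × Cart (m - k))) (x : M) :
    Cart k →L[ℝ] TangentSpace (𝓡 m) x :=
  ((mfderiv 𝓘(ℝ, Cart k × Cart (m - k)) (𝓡 m) ψ.symm (ψ x) :
    Cart k × Cart (m - k) →L[ℝ] Cart m)).comp (ContinuousLinearMap.inl ℝ (Cart k) (Cart (m - k)))

theorem exists_plot_horizontal {x : M} (hx : x ∈ ψ.source) :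
    ∃ c : Cart k → M, ContMDiff (𝓡 k) (𝓡 m) ∞ c ∧ (∀ t, F.rel x (c t)) ∧ c (ψ x).1 = x ∧
      (diffInto (m := m) c (ψ x).1 : Cart k →L[ℝ] Cart m) = horizontal ψ x := by
  have hxt : ψ x ∈ U ×ˢ W := h.target_eq ▸ ψ.map_source hx
  obtain ⟨b, hb, hbU, hbx⟩ := exists_smooth_retract (h.isOpen.mem_nhds hxt.1)
  have hι : ContDiff ℝ ∞ fun t ↦ (b t, (ψ x).2) := hb.prodMk contDiff_const
  have h1 : (b (ψ x).1, (ψ x).2) = ψ x := by simp [hbx.self_of_nhds]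
  refine ⟨fun t ↦ ψ.symm (b t, (ψ x).2), ?_, fun t ↦ h.rel_symm hx (hbU t), ?_, ?_⟩
  · refine contMDiffOn_univ.1 (h.contMDiffOn_symm.comp hι.contMDiff.contMDiffOn fun t _ ↦ ?_)
    rw [h.target_eq]
    exact ⟨hbU t, hxt.2⟩
  · exact (congrArg ψ.symm h1).trans (ψ.left_inv hx)
  · have h2 : HasFDerivAt (fun t ↦ (b t, (ψ x).2))
        (ContinuousLinearMap.inl ℝ (Cart k) (Cart (m - k))) (ψ x).1 :=
      ((hasFDerivAt_id _).congr_of_eventuallyEq hbx).prodMk (hasFDerivAt_const _ _)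
    have h3 : ∀ y, y = ψ x → HasMFDerivAt 𝓘(ℝ, Cart k × Cart (m - k)) (𝓡 m) ψ.symm y
        (mfderiv 𝓘(ℝ, Cart k × Cart (m - k)) (𝓡 m) ψ.symm (ψ x) :
          Cart k × Cart (m - k) →L[ℝ] Cart m) := by
      rintro _ rfl
      exact (h.mdifferentiable.mdifferentiableAt_symm (ψ.map_source hx)).hasMFDerivAt
    exact ((h3 _ h1).comp (ψ x).1 h2.hasMFDerivAt).mfderiv

theorem injective_horizontal {x : M} (hx : x ∈ ψ.source) :
    Function.Injective (horizontal ψ x) := by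
  have h1 := h.mdifferentiable.symm.mfderiv_injective (ψ.map_source hx)
  intro a b hab
  exact (Prod.mk.inj (h1 hab)).1

end IsFoliatedChart

variable [IsManifold (𝓡 m) ∞ M]

theorem diffInto_mem_tangent {n : ℕ} {c : Cart n → M} (hc : ContMDiff (𝓡 n) (𝓡 m) ∞ c)
    {z : Cart n} (hL : ∀ t, F.rel (c z) (c t)) (e : Cart n) :
    diffInto c z e ∈ F.tangent (c z) := by
  obtain ⟨k, ⟨S⟩, -⟩ := F.exists_chart (c z)
  exact ⟨k, S, S.diffInto_mem_tangent hc hL z e⟩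

theorem exists_plot_of_mem_tangent {x : M} {v : TangentSpace (𝓡 m) x} (hv : v ∈ F.tangent x) :
    ∃ (n : ℕ) (c : Cart n → M) (z e : Cart n), ContMDiff (𝓡 n) (𝓡 m) ∞ c ∧
      (∀ t, F.rel x (c t)) ∧ c z = x ∧ (diffInto (m := m) c z e : Cart m) = v := by
  obtain ⟨k, S, hS⟩ := hv
  exact ⟨k, S.exists_plot_of_mem_tangent hS⟩

theorem zero_mem_tangent (x : M) : 0 ∈ F.tangent x := by
  have h := F.diffInto_mem_tangent (c := fun _ : Cart 0 ↦ x) contMDiff_const (z := 0)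
    (fun _ ↦ F.rel.refl x) 0
  rwa [map_zero] at h

namespace IsFoliatedChart

variable {F} {k : ℕ} {ψ : OpenPartialHomeomorph M (Cart k × Cart (m - k))}
  {U : Set (Cart k)} {W : Set (Cart (m - k))} (h : F.IsFoliatedChart ψ U W)
include h

theorem horizontal_mem_tangent {x : M} (hx : x ∈ ψ.source) (a : Cart k) :
    horizontal ψ x a ∈ F.tangent x := by
  obtain ⟨c, hc, hL, hcx, hd⟩ := h.exists_plot_horizontal hx
  have key : ∀ y : M, y = x → ∀ v : Cart m, v ∈ F.tangent y → v ∈ F.tangent x := by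
    rintro y rfl v hv
    exact hv
  have h1 := F.diffInto_mem_tangent hc (z := (ψ x).1) (by rwa [hcx]) a
  have h2 := key _ hcx _ h1
  rwa [hd] at h2

/-- A dimension count: the horizontal space has dimension `k` and lies in the tangent space of the
leaf, of dimension at most `k`. At other points of the chart the leaf may be larger; only the
inclusion survives there. -/
theorem exists_horizontal_eq {x : M} (hx : x ∈ ψ.source) (S : WeaklyEmbedded m k (F.leaf x))
    {v : TangentSpace (𝓡 m) x} (hv : v ∈ F.tangent x) : ∃ a, horizontal ψ x a = v := by
  let _ := S.top
  let _ := S.charted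
  have _ := S.isManifold
  let T : Cart k →L[ℝ] Cart m :=
    mfderiv (𝓡 k) (𝓡 m) (Carrier.incl (F.leaf x)) (⟨x, F.rel.refl x⟩ : Carrier (F.leaf x))
  -- `F.tangent x` admits every weakly-embedded structure; passing through plots in the leaf brings
  -- all its vectors into the range for the fixed `S`.
  have key : ∀ {n : ℕ} {c : Cart n → M} (_ : ContMDiff (𝓡 n) (𝓡 m) ∞ c)
      (_ : ∀ t, F.rel x (c t)) {z : Cart n} (_ : c z = x) (e : Cart n),
      (diffInto (m := m) c z e : Cart m) ∈ LinearMap.range T.toLinearMap := by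
    intro n c hc hL z hz e
    subst hz
    exact S.diffInto_mem_tangent hc hL z e
  let H : Cart k →L[ℝ] Cart m := horizontal ψ x
  have hle : LinearMap.range H.toLinearMap ≤ LinearMap.range T.toLinearMap := by
    rintro _ ⟨a, rfl⟩
    obtain ⟨c, hc, hL, hcx, hd⟩ := h.exists_plot_horizontal hx
    have h1 := key hc hL hcx a
    rwa [hd] at h1
  have heq : LinearMap.range H.toLinearMap = LinearMap.range T.toLinearMap := by
    refine Submodule.eq_of_le_of_finrank_le hle ?_
    rw [LinearMap.finrank_range_of_inj (f := H.toLinearMap) (h.injective_horizontal hx)]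
    exact LinearMap.finrank_range_le T.toLinearMap
  obtain ⟨n, c, z, e, hc, hL, hz, rfl⟩ := F.exists_plot_of_mem_tangent hv
  have h1 := key hc hL hz e
  rw [← heq] at h1
  exact h1

theorem contMDiffOn_horizontal (a : Cart k) :
    ContMDiffOn (𝓡 m) (𝓡 m).tangent ∞
      (fun x ↦ (⟨x, horizontal ψ x a⟩ : TangentBundle (𝓡 m) M)) ψ.source := by
  have h1 := h.contMDiffOn_symm.contMDiffOn_tangentMapWithin (m := ∞) (by simp)
    ψ.open_target.uniqueMDiffOn
  have h2 : ContMDiff 𝓘(ℝ, Cart k × Cart (m - k)) 𝓘(ℝ, Cart k × Cart (m - k)).tangent ∞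
      (fun y ↦ (⟨y, (a, 0)⟩ : TangentBundle 𝓘(ℝ, Cart k × Cart (m - k)) _)) :=
    contMDiff_vectorSpace_iff_contDiff.2 contDiff_const
  refine (h1.comp (h2.comp_contMDiffOn h.contMDiffOn) fun x hx ↦ ψ.map_source hx).congr ?_
  intro x hx
  simp only [tangentMapWithin, Function.comp_apply]
  rw [mfderivWithin_of_isOpen ψ.open_target (ψ.map_source hx)]
  have key : ∀ y : M, y = x → ∀ v : Cart m,
      (⟨x, v⟩ : TangentBundle (𝓡 m) M) = ⟨y, v⟩ := by
    rintro _ rfl v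
    rfl
  exact key _ (ψ.left_inv hx) _

end IsFoliatedChart

/-- Every vector tangent to a leaf extends to a vector field tangent to the foliation. -/
theorem exists_isTangentField [T2Space M] {x : M} {v : TangentSpace (𝓡 m) x}
    (hv : v ∈ F.tangent x) : ∃ X, F.IsTangentField X ∧ X x = v := by
  obtain ⟨k, ⟨S⟩, ψ, U, W, h1, h2, hU, -, -, -, hT, hx, -, hleaf⟩ := F.exists_chart x
  have h : F.IsFoliatedChart ψ U W := ⟨h1, h2, hU, hT, hleaf⟩
  obtain ⟨a, rfl⟩ := h.exists_horizontal_eq hx S hv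
  obtain ⟨χ, -, hχ⟩ := (SmoothBumpFunction.nhds_basis_tsupport (I := 𝓡 m) x).mem_iff.1
    (ψ.open_source.mem_nhds hx)
  -- The horizontal field with constant coefficient `a` is tangent to every leaf meeting the chart.
  -- Since the support of χ is closed inside the chart, its cutoff extends smoothly by zero.
  refine ⟨(χ : M → ℝ) • fun y ↦ IsFoliatedChart.horizontal ψ y a, ⟨?_, fun y ↦ ?_⟩, ?_⟩
  · exact ContMDiffOn.smul_section_of_tsupport χ.contMDiff.contMDiffOn ψ.open_source hχ
      (h.contMDiffOn_horizontal a)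
  · by_cases hy : y ∈ ψ.source
    · have h3 := h.horizontal_mem_tangent hy (χ y • a)
      rwa [map_smul] at h3
    · have h3 : χ y = 0 := image_eq_zero_of_notMem_tsupport fun hy' ↦ hy (hχ hy')
      have h4 : ((χ : M → ℝ) • fun y ↦ IsFoliatedChart.horizontal ψ y a) y = 0 := by
        simp [h3]
      rw [h4]
      exact F.zero_mem_tangent y
  · simp

end SingularFoliation

end Tangent

/-! ### A pointwise characterization of basic forms -/

section Basic

variable {m : ℕ} {M : Type u} [TopologicalSpace M] [ChartedSpace (Cart m) M]

theorem diffInto_vectorInChart {φ : OpenPartialHomeomorph M (Cart m)}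
    (hφ : φ.MDifferentiable (𝓡 m) (𝓡 m)) (X : ∀ x : M, TangentSpace (𝓡 m) x) {y : Cart m}
    (hy : y ∈ φ.target) : diffInto φ.symm y (vectorInChart φ X y) = X (φ.symm y) := by
  have h1 := hφ.symm_comp_deriv (φ.map_target hy)
  have h2 := congrArg (fun A : Cart m →L[ℝ] Cart m ↦ A (X (φ.symm y))) h1
  have h3 : ∀ y', y' = y → (mfderiv (𝓡 m) (𝓡 m) φ.symm y' (vectorInChart φ X y) : Cart m) =
      mfderiv (𝓡 m) (𝓡 m) φ.symm y (vectorInChart φ X y) := by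
    rintro _ rfl
    rfl
  exact (h3 _ (φ.right_inv hy)).symm.trans h2

namespace SingularFoliation

variable (F : SingularFoliation m M)

/-- Forms that vanish as soon as one argument is tangent to a leaf. -/
def IsHorizontal {k : ℕ} (η : FormField m M k) : Prop :=
  ∀ (x : M) (w : Fin k → TangentSpace (𝓡 m) x) (i : Fin k), w i ∈ F.tangent x → η x w = 0

variable {F} in
theorem isHorizontal_of_cons {k : ℕ} {η : FormField m M (k + 1)}
    (h : ∀ x, ∀ v ∈ F.tangent x, ∀ w : Fin k → TangentSpace (𝓡 m) x,
      η x (Fin.cons (α := fun _ ↦ TangentSpace (𝓡 m) x) v w) = 0) : F.IsHorizontal η :=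
  fun x _ _ hi ↦ alternating_eq_zero_of_cons (h x _ hi) rfl

end SingularFoliation

variable [IsManifold (𝓡 m) ∞ M]

theorem differentiableAt_vectorInChart {X : ∀ x : M, TangentSpace (𝓡 m) x}
    (hX : ContMDiff (𝓡 m) (𝓡 m).tangent ∞ (fun x ↦ (⟨x, X x⟩ : TangentBundle (𝓡 m) M))) (x : M) :
    DifferentiableAt ℝ (vectorInChart (chartAt (Cart m) x) X) (chartAt (Cart m) x x) := by
  set φ := chartAt (Cart m) x
  have hφ := IsManifold.chart_mem_maximalAtlas (I := 𝓡 m) (n := ∞) x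
  have h1 := (contMDiffOn_of_mem_maximalAtlas hφ).contMDiffOn_tangentMapWithin (m := ∞) (by simp)
    φ.open_source.uniqueMDiffOn
  have h2 := h1.comp (hX.comp_contMDiffOn (contMDiffOn_symm_of_mem_maximalAtlas hφ))
    fun y hy ↦ φ.map_target hy
  have h3 := contMDiff_snd_tangentBundle_modelSpace (Cart m) (𝓡 m) (n := ∞) |>.comp_contMDiffOn h2
  have h4 := (contMDiffOn_iff_contDiffOn.1 h3).contDiffAt
    (φ.open_target.mem_nhds (mem_chart_target (Cart m) x))
  refine (h4.differentiableAt (by simp)).congr_of_eventuallyEq ?_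
  filter_upwards [φ.open_target.mem_nhds (mem_chart_target (Cart m) x)] with y hy
  exact congrArg (fun A : Cart m →L[ℝ] Cart m ↦ A (X (φ.symm y)))
    (mfderivWithin_of_isOpen φ.open_source (φ.map_target hy)).symm

theorem lieDeriv_eq_d {k : ℕ} {η : FormField m M k} (hη : η ∈ ManifoldForm m M k)
    {X : ∀ x : M, TangentSpace (𝓡 m) x}
    (hX : ContMDiff (𝓡 m) (𝓡 m).tangent ∞ (fun x ↦ (⟨x, X x⟩ : TangentBundle (𝓡 m) M)))
    (h : ∀ x (w : Fin k → TangentSpace (𝓡 m) x) i, w i = X x → η x w = 0)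
    (x : M) (w : Fin k → TangentSpace (𝓡 m) x) :
    lieDeriv X η x w = η.d x (Fin.cons (α := fun _ ↦ TangentSpace (𝓡 m) x) (X x) w) := by
  set φ := chartAt (Cart m) x
  have hxs : x ∈ φ.source := mem_chart_source (Cart m) x
  have h1 := lieDerivCart_eq_extDeriv (differentiableAt_vectorInChart hX x)
    (SingularFoliation.inChart_differentiableAt hη x) (by
      filter_upwards [φ.open_target.mem_nhds (mem_chart_target (Cart m) x)] with y hy w i hi
      refine h (φ.symm y) (fun i ↦ diffInto φ.symm y (w i)) i ?_
      exact (congrArg (diffInto φ.symm y) hi).trans <|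
        diffInto_vectorInChart (mdifferentiable_chart x) X hy) fun i ↦ diffOutOf φ x (w i)
  refine h1.trans ?_
  have h3 : ∀ y, y = x → (mfderiv (𝓡 m) (𝓡 m) φ y (X y) : Cart m) =
      mfderiv (𝓡 m) (𝓡 m) φ x (X x) := by
    rintro _ rfl
    rfl
  have h2 : vectorInChart φ X (φ x) = diffOutOf φ x (X x) := h3 _ (φ.left_inv hxs)
  rw [h2]
  refine congrArg (extDeriv (η.inChart φ) (φ x)) ?_
  ext i : 1
  refine Fin.cases rfl (fun i ↦ rfl) i

namespace SingularFoliation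

variable (F : SingularFoliation m M)

/-- Once ι_X η = 0, Cartan's formula gives L_X η = ι_X dη. As every tangent vector extends to a
tangent field, both conditions are pointwise, and no vector field has to be lifted through a
submersion later. -/
theorem mem_basicForms_iff [T2Space M] {k : ℕ} {η : FormField m M k} :
    η ∈ F.basicForms k ↔ η ∈ ManifoldForm m M k ∧ F.IsHorizontal η ∧ F.IsHorizontal η.d := by
  constructor
  · rintro ⟨hη, h⟩
    have hann : ∀ X, F.IsTangentField X → ∀ x (w : Fin k → TangentSpace (𝓡 m) x) i,
        w i = X x → η x w = 0 := by
      intro X hX x w i hi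
      cases k with
      | zero => exact i.elim0
      | succ k => exact alternating_eq_zero_of_cons ((h X hX).1 x) hi
    refine ⟨hη, fun x w i hi ↦ ?_, isHorizontal_of_cons fun x v hv w ↦ ?_⟩
    · obtain ⟨X, hX, hXx⟩ := F.exists_isTangentField hi
      exact hann X hX x w i hXx.symm
    · obtain ⟨X, hX, rfl⟩ := F.exists_isTangentField hv
      rw [← lieDeriv_eq_d hη hX.1 (hann X hX), (h X hX).2]
      rfl
  · rintro ⟨hη, h1, h2⟩
    refine ⟨hη, fun X hX ↦ ⟨?_, ?_⟩⟩
    · cases k with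
      | zero => trivial
      | succ k => exact fun x v ↦ h1 x _ 0 (hX.2 x)
    · funext x
      ext w
      rw [lieDeriv_eq_d hη hX.1 fun x w i hi ↦ h1 x w i (hi ▸ hX.2 x)]
      exact h2 x _ 0 (hX.2 x)

end SingularFoliation

end Basic

/-! ### Submersions in adapted plots -/

theorem exists_rightInverse_of_surjective
    {E F : Type*} [NormedAddCommGroup E] [NormedSpace ℝ E] [NormedAddCommGroup F] [NormedSpace ℝ F]
    [FiniteDimensional ℝ F] {A : E →L[ℝ] F} (hA : Function.Surjective A) :
    ∃ B : F →L[ℝ] E, ∀ v, A (B v) = v := by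
  obtain ⟨g, hg⟩ := A.toLinearMap.exists_rightInverse_of_surjective (LinearMap.range_eq_top.2 hA)
  exact ⟨LinearMap.toContinuousLinearMap g, fun v ↦ LinearMap.congr_fun hg v⟩

section Submersion

variable {m n : ℕ} {M : Type u} [TopologicalSpace M] [ChartedSpace (Cart m) M]
  {N : Type v} [TopologicalSpace N] [ChartedSpace (Cart n) N]

/-- A plot `q` of `M`, a local parametrization on a ball, in which the map `p : M → N` is the linear
map `π` with respect to the chart `ψ`. -/
structure IsAdaptedPlot (p : M → N) (ψ : OpenPartialHomeomorph N (Cart n))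
    (π : Cart m →L[ℝ] Cart n) (q : Cart m → M) (z : Cart m) (ε : ℝ) : Prop where
  mem_maximalAtlas : ψ ∈ IsManifold.maximalAtlas (𝓡 n) ∞ N
  surjective : Function.Surjective π
  contMDiff : ContMDiff (𝓡 m) (𝓡 m) ∞ q
  pos : 0 < ε
  mem_source : ∀ y ∈ Metric.ball z ε, p (q y) ∈ ψ.source
  apply_eq : ∀ y ∈ Metric.ball z ε, ψ (p (q y)) = π y
  diff_surjective : ∀ y ∈ Metric.ball z ε, Function.Surjective (diffInto (m := m) q y)
  image_mem_nhds : q '' Metric.ball z ε ∈ 𝓝 (q z)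

/-- This is the local normal form of a submersion, with the inverse of the domain chart extended to
a plot. -/
theorem exists_isAdaptedPlot {p : M → N} (hp : Manifold.IsSubmersion (𝓡 m) (𝓡 n) ∞ p) (x : M) :
    ∃ (ψ : OpenPartialHomeomorph N (Cart n)) (π : Cart m →L[ℝ] Cart n) (q : Cart m → M)
      (z : Cart m) (ε : ℝ), IsAdaptedPlot p ψ π q z ε ∧ q z = x := by
  obtain ⟨E, _, _, h⟩ := hp.isSubmersionAt x
  set φ := h.domChart
  have hφ := h.domChart_mem_maximalAtlas
  have hx := h.mem_domChart_source
  have hz : φ x ∈ φ.target := φ.map_source hx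
  obtain ⟨q, hq, he⟩ := exists_plot hφ hz
  obtain ⟨ε, hε, hball⟩ := Metric.mem_nhds_iff.1
    (Filter.inter_mem (φ.open_target.mem_nhds hz) he.eventually_nhds)
  have hqx : q (φ x) = x := he.self_of_nhds.trans (φ.left_inv hx)
  have heq : ∀ y ∈ Metric.ball (φ x) ε, q y = φ.symm y := fun y hy ↦ (hball hy).2.self_of_nhds
  refine ⟨h.codChart, (ContinuousLinearMap.fst ℝ _ _).comp h.equiv.toContinuousLinearMap, q, φ x,
    ε, ⟨h.codChart_mem_maximalAtlas, Prod.fst_surjective.comp h.equiv.surjective, hq, hε,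
      fun y hy ↦ ?_, fun y hy ↦ ?_, fun y hy ↦ ?_, ?_⟩, hqx⟩
  · rw [heq y hy]
    exact h.source_subset_preimage_source (φ.map_target (hball hy).1)
  · rw [heq y hy]
    exact h.writtenInCharts (by simpa using (hball hy).1)
  · have h0 : q =ᶠ[𝓝 y] φ.symm := (hball hy).2
    have h1 : diffInto (m := m) q y = mfderiv (𝓡 m) (𝓡 m) φ.symm y := h0.mfderiv_eq
    rw [h1]
    exact (mdifferentiable_of_mem_maximalAtlas hφ).symm.mfderiv_surjective (hball hy).1
  · rw [Set.image_congr heq, hqx]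
    have h1 := φ.symm.image_mem_nhds hz (Metric.ball_mem_nhds (φ x) hε)
    rwa [φ.left_inv hx] at h1

namespace IsAdaptedPlot

variable {p : M → N} {ψ : OpenPartialHomeomorph N (Cart n)} {π : Cart m →L[ℝ] Cart n}
  {q : Cart m → M} {z : Cart m} {ε : ℝ} (h : IsAdaptedPlot p ψ π q z ε)
include h

theorem map_eq {y : Cart m} (hy : y ∈ Metric.ball z ε) : p (q y) = ψ.symm (π y) := by
  rw [← h.apply_eq y hy, ψ.left_inv (h.mem_source y hy)]

theorem diffInto_eq {y : Cart m} (hy : y ∈ Metric.ball z ε) :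
    (diffInto (p ∘ q) y : Cart m →L[ℝ] Cart n) =
      (diffInto ψ.symm (π y) : _ →L[ℝ] Cart n).comp π := by
  have h1 : p ∘ q =ᶠ[𝓝 y] ψ.symm ∘ π := by
    filter_upwards [Metric.isOpen_ball.mem_nhds hy] with t ht
    exact h.map_eq ht
  have h2 : π y ∈ ψ.target := by
    rw [← h.apply_eq y hy]
    exact ψ.map_source (h.mem_source y hy)
  have h3 := mfderiv_comp (I := 𝓡 m) (I' := 𝓡 n) (I'' := 𝓡 n) y
    ((contMDiffAt_symm_of_mem_maximalAtlas h.mem_maximalAtlas h2).mdifferentiableAt (by simp))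
    π.differentiableAt.mdifferentiableAt
  refine h1.mfderiv_eq.trans (h3.trans ?_)
  rw [mfderiv_eq_fderiv, π.fderiv]
  rfl

theorem diffInto_surjective {y : Cart m} (hy : y ∈ Metric.ball z ε) :
    Function.Surjective (diffInto (m := n) (p ∘ q) y : Cart m →L[ℝ] Cart n) := by
  rw [h.diffInto_eq hy]
  have h2 : π y ∈ ψ.target := by
    rw [← h.apply_eq y hy]
    exact ψ.map_source (h.mem_source y hy)
  exact ((mdifferentiable_of_mem_maximalAtlas h.mem_maximalAtlas).symm.mfderiv_surjective h2).comp
    h.surjective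

theorem eq_zero_of_diffInto_eq_zero {y : Cart m} (hy : y ∈ Metric.ball z ε) {e : Cart m}
    (he : (diffInto (m := n) (p ∘ q) y : Cart m →L[ℝ] Cart n) e = 0) : π e = 0 := by
  rw [h.diffInto_eq hy] at he
  have h2 : π y ∈ ψ.target := by
    rw [← h.apply_eq y hy]
    exact ψ.map_source (h.mem_source y hy)
  refine (mdifferentiable_of_mem_maximalAtlas h.mem_maximalAtlas).symm.mfderiv_injective h2 ?_
  exact he.trans (map_zero _).symm

/-- A lift exists only near `t`; the reparametrization `b` makes it global without changing the germ
of `c` at `t`. -/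
theorem exists_lift {l : ℕ} {c : Cart l → N} (hc : ContMDiff (𝓡 l) (𝓡 n) ∞ c) {t : Cart l}
    (ht : c t = p (q z)) : ∃ (b : Cart l → Cart l) (d : Cart l → M), ContDiff ℝ ∞ b ∧
      b =ᶠ[𝓝 t] id ∧ ContMDiff (𝓡 l) (𝓡 m) ∞ d ∧ d t = q z ∧ p ∘ d = c ∘ b := by
  obtain ⟨σ, hσ⟩ := exists_rightInverse_of_surjective h.surjective
  have hz := Metric.mem_ball_self (x := z) h.pos
  -- Since σ is a linear section of π, π (g s) = ψ (c s); thus `q ∘ g` lifts `c` where `c s` is in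
  -- the chart and `g s` in the ball.
  let g : Cart l → Cart m := fun s ↦ z + σ (ψ (c s) - π z)
  have hgt : g t = z := by
    simp only [g, ht, h.apply_eq z hz]
    simp
  let V : Set (Cart l) := c ⁻¹' ψ.source
  have hV : IsOpen V := ψ.open_source.preimage hc.continuous
  have hψc : ContDiffOn ℝ ∞ (ψ ∘ c) V := contMDiffOn_iff_contDiffOn.1 <|
    (contMDiffOn_of_mem_maximalAtlas h.mem_maximalAtlas).comp hc.contMDiffOn fun s hs ↦ hs
  have hg : ContDiffOn ℝ ∞ g V := contDiffOn_const.add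
    (σ.contDiff.comp_contDiffOn (hψc.sub contDiffOn_const))
  have hV' : V ∩ g ⁻¹' Metric.ball z ε ∈ 𝓝 t := by
    refine (hg.continuousOn.isOpen_inter_preimage hV Metric.isOpen_ball).mem_nhds ⟨?_, ?_⟩
    · simpa [V, ht] using h.mem_source z hz
    · simpa [hgt] using h.pos
  obtain ⟨b, hb, hbV, hbt⟩ := exists_smooth_retract hV'
  refine ⟨b, q ∘ g ∘ b, hb, hbt, ?_, ?_, funext fun s ↦ ?_⟩
  · exact h.contMDiff.comp
      (hg.comp_contDiff hb fun s ↦ (hbV s).1).contMDiff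
  · simp [hbt.self_of_nhds, hgt]
  · have h1 := (hbV s).2
    refine ψ.injOn (h.mem_source _ h1) (hbV s).1 ((h.apply_eq _ h1).trans ?_)
    simp [g, hσ]

end IsAdaptedPlot

theorem exists_lift_of_isSubmersion {p : M → N} (hp : Manifold.IsSubmersion (𝓡 m) (𝓡 n) ∞ p)
    {l : ℕ} {c : Cart l → N} (hc : ContMDiff (𝓡 l) (𝓡 n) ∞ c) {t : Cart l} {x : M}
    (ht : c t = p x) : ∃ (b : Cart l → Cart l) (d : Cart l → M), ContDiff ℝ ∞ b ∧
      b =ᶠ[𝓝 t] id ∧ ContMDiff (𝓡 l) (𝓡 m) ∞ d ∧ d t = x ∧ p ∘ d = c ∘ b := by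
  obtain ⟨ψ, π, q, z, ε, h, rfl⟩ := exists_isAdaptedPlot hp x
  exact h.exists_lift hc ht

end Submersion

/-- A multilinear function that vanishes on the kernel of a linear map only depends on the images
of its arguments. -/
theorem apply_eq_of_map_eq {E F : Type*} [NormedAddCommGroup E] [NormedSpace ℝ E] [AddCommGroup F]
    [Module ℝ F] {k : ℕ} {β : E [⋀^Fin k]→L[ℝ] ℝ} {A : E →ₗ[ℝ] F}
    (hβ : ∀ (w : Fin k → E) (i : Fin k), A (w i) = 0 → β w = 0) {w w' : Fin k → E}
    (h : ∀ i, A (w i) = A (w' i)) : β w = β w' := by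
  -- Exchange the arguments one at a time: each exchange alters β by a value with `w j - w' j`, a
  -- kernel vector, in slot `j`.
  have key : ∀ s : Finset (Fin k), β (s.piecewise w w') = β w' := by
    intro s
    induction s using Finset.induction_on with
    | empty => simp
    | insert j s hj ih =>
      rw [Finset.piecewise_insert, ← ih, ← sub_eq_zero]
      have h1 : s.piecewise w w' = Function.update (s.piecewise w w') j (w' j) := by
        rw [eq_comm, Function.update_eq_self_iff]
        simp [hj]
      conv_lhs => rw [h1, Function.update_idem]
      rw [← ContinuousAlternatingMap.map_update_sub]
      exact hβ _ j (by simp [h])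
  simpa using key Finset.univ

/-! ### Transport of basic forms along a span of submersions -/

section Span

variable {n₀ n₁ m : ℕ}
  {N₀ : Type u} [TopologicalSpace N₀] [ChartedSpace (Cart n₀) N₀]
  {N₁ : Type v} [TopologicalSpace N₁] [ChartedSpace (Cart n₁) N₁]
  {M : Type w} [TopologicalSpace M] [ChartedSpace (Cart m) M]

/-- Two maps out of `M`, surjective submersions with connected fibers, that pull back the partitions
into leaves to the same partition of `M`. -/
structure IsSpan (F₀ : SingularFoliation n₀ N₀) (F₁ : SingularFoliation n₁ N₁)
    (p₀ : M → N₀) (p₁ : M → N₁) : Prop where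
  left : IsConnectedSubmersion (m := m) (n := n₀) p₀
  right : IsConnectedSubmersion (m := m) (n := n₁) p₁
  rel_iff : ∀ x x', F₀.rel (p₀ x) (p₀ x') ↔ F₁.rel (p₁ x) (p₁ x')

theorem IsSpan.symm {F₀ : SingularFoliation n₀ N₀} {F₁ : SingularFoliation n₁ N₁}
    {p₀ : M → N₀} {p₁ : M → N₁} (h : IsSpan (m := m) F₀ F₁ p₀ p₁) :
    IsSpan (m := m) F₁ F₀ p₁ p₀ :=
  ⟨h.right, h.left, fun x x' ↦ (h.rel_iff x x').symm⟩

theorem SingularFoliation.IsPullback.rel_iff {p : M → N₀} {G : SingularFoliation n₀ N₀}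
    {F : SingularFoliation m M} (h : IsPullback p G F) (x x' : M) :
    F.rel x x' ↔ G.rel (p x) (p x') := by
  obtain ⟨y, hy⟩ : F.leaf x ∈ {L : Set M | ∃ y, L = p ⁻¹' G.leaf y} := h ▸ ⟨x, rfl⟩
  have h1 : G.rel y (p x) := (hy ▸ F.rel.refl x : x ∈ p ⁻¹' G.leaf y)
  calc F.rel x x' ↔ x' ∈ F.leaf x := Iff.rfl
    _ ↔ G.rel y (p x') := by rw [hy]; rfl
    _ ↔ G.rel (p x) (p x') := ⟨fun h2 ↦ G.rel.trans (G.rel.symm h1) h2, G.rel.trans h1⟩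

theorem MolinoEquivalent.exists_isSpan {F₀ : SingularFoliation n₀ N₀}
    {F₁ : SingularFoliation n₁ N₁} (h : MolinoEquivalent.{u, v, w} F₀ F₁) :
    ∃ (m : ℕ) (M : Type w) (_ : TopologicalSpace M) (_ : ChartedSpace (Cart m) M)
      (_ : IsManifold (𝓡 m) ∞ M) (p₀ : M → N₀) (p₁ : M → N₁),
      IsSpan (m := m) F₀ F₁ p₀ p₁ := by
  obtain ⟨m, M, _, _, _, _, _, F, p₀, p₁, h₀, h₁, hF₀, hF₁⟩ := h
  exact ⟨m, M, _, _, ‹_›, p₀, p₁, h₀, h₁,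
    fun x x' ↦ (hF₀.rel_iff x x').symm.trans (hF₁.rel_iff x x')⟩

/-- The pullbacks of two forms to `M`, tested on plots, agree. -/
def PullbacksAgree (m : ℕ) {M : Type w} [TopologicalSpace M] [ChartedSpace (Cart m) M]
    (p₀ : M → N₀) (p₁ : M → N₁) {k : ℕ} (η₀ : FormField n₀ N₀ k) (η₁ : FormField n₁ N₁ k) : Prop :=
  ∀ (l : ℕ) (q : Cart l → M), ContMDiff (𝓡 l) (𝓡 m) ∞ q →
    η₀.pullback (p₀ ∘ q) = η₁.pullback (p₁ ∘ q)

section Rel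

variable {p₀ : M → N₀} {p₁ : M → N₁} {k : ℕ} {η₀ : FormField n₀ N₀ k} {η₁ : FormField n₁ N₁ k}

theorem PullbacksAgree.symm (h : PullbacksAgree m p₀ p₁ η₀ η₁) : PullbacksAgree m p₁ p₀ η₁ η₀ :=
  fun l q hq ↦ (h l q hq).symm

variable {F₀ : SingularFoliation n₀ N₀} {F₁ : SingularFoliation n₁ N₁}

theorem PullbacksAgree.exists_pullback_eq (h : PullbacksAgree m p₀ p₁ η₀ η₁)
    (hs : IsConnectedSubmersion (m := m) (n := n₀) p₀) {l : ℕ} {c : Cart l → N₀}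
    (hc : ContMDiff (𝓡 l) (𝓡 n₀) ∞ c) (t : Cart l) :
    ∃ d : Cart l → M, ContMDiff (𝓡 l) (𝓡 m) ∞ d ∧
      η₀.pullback c =ᶠ[𝓝 t] η₁.pullback (p₁ ∘ d) := by
  obtain ⟨x, hx⟩ := hs.1 (c t)
  obtain ⟨b, d, hb, hbt, hd, -, hcd⟩ := exists_lift_of_isSubmersion hs.2.1 hc hx.symm
  refine ⟨d, hd, ?_⟩
  filter_upwards [hbt.eventually_nhds] with s hs
  rw [← h l d hd, hcd, FormField.pullback_comp_eq_of_eventuallyEq_id _ _ hs]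

theorem diffInto_comp {l n : ℕ} {N : Type*} [TopologicalSpace N] [ChartedSpace (Cart n) N]
    {p : M → N} (hp : ContMDiff (𝓡 m) (𝓡 n) ∞ p) {q : Cart l → M}
    (hq : ContMDiff (𝓡 l) (𝓡 m) ∞ q) (z e : Cart l) :
    diffInto (m := n) (p ∘ q) z e = mfderiv (𝓡 m) (𝓡 n) p (q z) (diffInto (m := m) q z e) :=
  congrArg (fun A : Cart l →L[ℝ] Cart n ↦ A e)
    (mfderiv_comp z (hp.mdifferentiableAt (by simp)) (hq.mdifferentiableAt (by simp)))

theorem diffInto_comp_congr {l l' n : ℕ} {N : Type*} [TopologicalSpace N] [ChartedSpace (Cart n) N]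
    {p : M → N} (hp : ContMDiff (𝓡 m) (𝓡 n) ∞ p) {q : Cart l → M} {d : Cart l' → M}
    (hq : ContMDiff (𝓡 l) (𝓡 m) ∞ q) (hd : ContMDiff (𝓡 l') (𝓡 m) ∞ d) {z e : Cart l}
    {z' e' : Cart l'} (hz : d z' = q z)
    (h : (diffInto (m := m) q z e : Cart m) = diffInto (m := m) d z' e') :
    (diffInto (m := n) (p ∘ q) z e : Cart n) = diffInto (m := n) (p ∘ d) z' e' := by
  have key : ∀ (x x' : M) (v v' : Cart m), x = x' → v = v' →
      (mfderiv (𝓡 m) (𝓡 n) p x v : Cart n) = mfderiv (𝓡 m) (𝓡 n) p x' v' := by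
    rintro x _ v _ rfl rfl
    rfl
  exact (diffInto_comp hp hq z e).trans
    ((key _ _ _ _ hz.symm h).trans (diffInto_comp hp hd z' e').symm)

/-- The pullbacks of an alternating form `ζ` at `p₀ x` and of `η₁` to the tangent space at `x`
agree. -/
def AgreesAt (m : ℕ) {M : Type w} [TopologicalSpace M] [ChartedSpace (Cart m) M] (p₀ : M → N₀)
    (p₁ : M → N₁) {k : ℕ} (η₁ : FormField n₁ N₁ k) (x : M) (ζ : Cart n₀ [⋀^Fin k]→L[ℝ] ℝ) : Prop :=
  ∀ w : Fin k → Cart m, ζ (fun i ↦ mfderiv (𝓡 m) (𝓡 n₀) p₀ x (w i)) =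
    η₁ (p₁ x) (fun i ↦ mfderiv (𝓡 m) (𝓡 n₁) p₁ x (w i))

/-- Surjectivity of the differential of `q` lets agreement at `q y` be tested on ℝˡ, a space that
does not vary with the point. -/
theorem IsSpan.agreesAt_iff (hs : IsSpan (m := m) F₀ F₁ p₀ p₁) {l : ℕ} {q : Cart l → M}
    (hq : ContMDiff (𝓡 l) (𝓡 m) ∞ q) {y : Cart l}
    (hy : Function.Surjective (diffInto (m := m) q y)) {ζ : Cart n₀ [⋀^Fin k]→L[ℝ] ℝ} :
    AgreesAt m p₀ p₁ η₁ (q y) ζ ↔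
      ζ.compContinuousLinearMap (diffInto (m := n₀) (p₀ ∘ q) y : Cart l →L[ℝ] Cart n₀) =
        η₁.pullback (p₁ ∘ q) y := by
  have h0 : ∀ a : Fin k → Cart l,
      ζ.compContinuousLinearMap (diffInto (m := n₀) (p₀ ∘ q) y : Cart l →L[ℝ] Cart n₀) a =
        ζ (fun i ↦ mfderiv (𝓡 m) (𝓡 n₀) p₀ (q y) (diffInto (m := m) q y (a i))) := fun a ↦
    congrArg ζ (funext fun i ↦ diffInto_comp hs.left.2.1.contMDiff hq y (a i))
  have h1 : ∀ a : Fin k → Cart l, η₁.pullback (p₁ ∘ q) y a =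
      η₁ (p₁ (q y)) (fun i ↦ mfderiv (𝓡 m) (𝓡 n₁) p₁ (q y) (diffInto (m := m) q y (a i))) :=
    fun a ↦ congrArg (η₁ (p₁ (q y)))
      (funext fun i ↦ diffInto_comp hs.right.2.1.contMDiff hq y (a i))
  constructor
  · intro h
    ext a
    rw [h0, h1]
    exact h _
  · intro h w
    choose a haw using fun i ↦ hy (w i)
    have h2 : w = fun i ↦ diffInto (m := m) q y (a i) := funext fun i ↦ (haw i).symm
    have h3 := congrArg (fun A : Cart l [⋀^Fin k]→L[ℝ] ℝ ↦ A a) h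
    rw [h2]
    exact (h0 a).symm.trans (h3.trans (h1 a))

/-! ### Uniqueness and basicness of forms with equal pullbacks -/

variable [IsManifold (𝓡 n₀) ∞ N₀]

theorem PullbacksAgree.eq_left {η₀' : FormField n₀ N₀ k} (h : PullbacksAgree m p₀ p₁ η₀ η₁)
    (h' : PullbacksAgree m p₀ p₁ η₀' η₁) (hs : IsSpan (m := m) F₀ F₁ p₀ p₁) : η₀ = η₀' := by
  refine FormField.ext_of_pullback fun c hc ↦ funext fun t ↦ ?_
  obtain ⟨x, hx⟩ := hs.left.1 (c t)
  obtain ⟨b, d, hb, hbt, hd, -, hcd⟩ := exists_lift_of_isSubmersion hs.left.2.1 hc hx.symm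
  rw [← FormField.pullback_comp_eq_of_eventuallyEq_id η₀ c hbt,
    ← FormField.pullback_comp_eq_of_eventuallyEq_id η₀' c hbt, ← hcd, h _ d hd, h' _ d hd]

variable [IsManifold (𝓡 n₁) ∞ N₁]

theorem PullbacksAgree.d (h : PullbacksAgree m p₀ p₁ η₀ η₁) (hη₀ : η₀ ∈ ManifoldForm n₀ N₀ k)
    (hη₁ : η₁ ∈ ManifoldForm n₁ N₁ k) (hs : IsSpan (m := m) F₀ F₁ p₀ p₁) :
    PullbacksAgree m p₀ p₁ η₀.d η₁.d := by
  intro l q hq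
  rw [FormField.pullback_d hη₀ (hs.left.2.1.contMDiff.comp hq),
    FormField.pullback_d hη₁ (hs.right.2.1.contMDiff.comp hq), h l q hq]

theorem PullbacksAgree.mem_manifoldForm (h : PullbacksAgree m p₀ p₁ η₀ η₁)
    (hη₁ : η₁ ∈ ManifoldForm n₁ N₁ k) (hs : IsSpan (m := m) F₀ F₁ p₀ p₁) :
    η₀ ∈ ManifoldForm n₀ N₀ k := by
  refine mem_manifoldForm_iff.2 fun l c hc ↦ contDiff_iff_contDiffAt.2 fun t ↦ ?_
  obtain ⟨d, hd, he⟩ := h.exists_pullback_eq hs.left hc t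
  exact (mem_manifoldForm_iff.1 hη₁ l _
    (hs.right.2.1.contMDiff.comp hd)).contDiffAt.congr_of_eventuallyEq he

/-- A leaf-tangent vector is the velocity of a plot `c` in a leaf of `F₀`. A lift `d` of `c` to `M`
projects under `p₁` into one leaf of `F₁`, so the lifted velocity becomes tangent to `F₁`, where η₁
vanishes. -/
theorem PullbacksAgree.isHorizontal (h : PullbacksAgree m p₀ p₁ η₀ η₁)
    (hη₁ : F₁.IsHorizontal η₁) (hs : IsSpan (m := m) F₀ F₁ p₀ p₁) : F₀.IsHorizontal η₀ := by
  have hp₀ := hs.left.2.1.contMDiff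
  have hp₁ := hs.right.2.1.contMDiff
  intro y w i hi
  obtain ⟨x, rfl⟩ := hs.left.1 y
  obtain ⟨ψ, π, q, z, ε, ha, rfl⟩ := exists_isAdaptedPlot hs.left.2.1 x
  have hz := Metric.mem_ball_self (x := z) ha.pos
  obtain ⟨l, c, t, e, hc, hL, hct, hce⟩ := F₀.exists_plot_of_mem_tangent hi
  obtain ⟨b, d, hb, hbt, hd, hdt, hcd⟩ := ha.exists_lift hc hct
  choose a ha' using fun j ↦ ha.diffInto_surjective hz (w j)
  -- Argument `i` must be lifted to the velocity of `d`; the other arguments may be lifted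
  -- arbitrarily.
  obtain ⟨ai, hai⟩ := ha.diff_surjective z hz (diffInto (m := m) d t e : Cart m)
  have hw : ∀ j, (diffInto (m := n₀) (p₀ ∘ q) z (Function.update a i ai j) : Cart n₀) = w j := by
    intro j
    by_cases hj : j = i
    · subst hj
      rw [Function.update_self]
      refine (diffInto_comp_congr hp₀ ha.contMDiff hd hdt hai).trans ?_
      have h1 : (diffInto (m := n₀) (p₀ ∘ d) t : Cart l →L[ℝ] Cart n₀) = diffInto c t := by
        rw [hcd]
        exact (hbt.fun_comp c).mfderiv_eq
      rw [h1]
      exact hce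
    · rw [Function.update_of_ne hj]
      exact ha' j
  have h1 : η₀ (p₀ (q z)) w = η₀.pullback (p₀ ∘ q) z (Function.update a i ai) := by
    have h2 : w = fun j ↦ diffInto (m := n₀) (p₀ ∘ q) z (Function.update a i ai j) :=
      funext fun j ↦ (hw j).symm
    rw [h2]
    rfl
  rw [h1, h _ q ha.contMDiff]
  refine hη₁ (p₁ (q z)) (fun j ↦ diffInto (m := n₁) (p₁ ∘ q) z (Function.update a i ai j)) i ?_
  rw [Function.update_self]
  have h3 := F₁.diffInto_mem_tangent (c := p₁ ∘ d) (hp₁.comp hd) (z := t) (fun s ↦ by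
    have h4 : ∀ r, p₀ (d r) = c (b r) := congrFun hcd
    refine (hs.rel_iff _ _).1 ?_
    rw [h4, h4]
    exact F₀.rel.trans (F₀.rel.symm (hL _)) (hL _)) e
  have key : ∀ x x' : M, x = x' → ∀ v v' : Cart n₁, v = v' → v ∈ F₁.tangent (p₁ x) →
      v' ∈ F₁.tangent (p₁ x') := by
    rintro x _ rfl v _ rfl hv
    exact hv
  exact key _ _ hdt _ _ (diffInto_comp_congr hp₁ ha.contMDiff hd hdt hai).symm h3

theorem PullbacksAgree.mem_basicForms [T2Space N₀] [T2Space N₁]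
    (h : PullbacksAgree m p₀ p₁ η₀ η₁) (hη₁ : η₁ ∈ F₁.basicForms k)
    (hs : IsSpan (m := m) F₀ F₁ p₀ p₁) : η₀ ∈ F₀.basicForms k := by
  rw [SingularFoliation.mem_basicForms_iff] at hη₁ ⊢
  have h0 := h.mem_manifoldForm hη₁.1 hs
  exact ⟨h0, h.isHorizontal hη₁.2.1 hs, (h.d h0 hη₁.1 hs).isHorizontal hη₁.2.2 hs⟩

-- Inside the ball, `q` maps the affine subspace y + ker π into one fiber of `p₀`, hence `p₁ ∘ q`
-- maps it into one leaf of `F₁`.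
omit [IsManifold (𝓡 n₀) ∞ N₀] in
theorem IsSpan.diffInto_mem_tangent (hs : IsSpan (m := m) F₀ F₁ p₀ p₁)
    {ψ : OpenPartialHomeomorph N₀ (Cart n₀)} {π : Cart m →L[ℝ] Cart n₀} {q : Cart m → M}
    {z : Cart m} {ε : ℝ} (ha : IsAdaptedPlot p₀ ψ π q z ε) {y : Cart m}
    (hy : y ∈ Metric.ball z ε) {e : Cart m} (he : π e = 0) :
    diffInto (p₁ ∘ q) y e ∈ F₁.tangent (p₁ (q y)) := by
  obtain ⟨σ, hσ⟩ := exists_rightInverse_of_surjective ha.surjective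
  -- The projection onto ker π along the range of σ; `r` then projects onto y + ker π with
  -- differential κ, which fixes `e`.
  let κ : Cart m →L[ℝ] Cart m := ContinuousLinearMap.id ℝ _ - σ.comp π
  have hπκ : ∀ v, π (κ v) = 0 := fun v ↦ by simp [κ, hσ]
  have hκe : κ e = e := by simp [κ, he]
  let r : Cart m → Cart m := fun t ↦ y + κ (t - y)
  have hr : ContDiff ℝ ∞ r := contDiff_const.add (κ.contDiff.comp (contDiff_id.sub contDiff_const))
  have hry : r y = y := by simp [r]
  have hV : r ⁻¹' Metric.ball z ε ∈ 𝓝 y :=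
    hr.continuous.continuousAt.preimage_mem_nhds (Metric.isOpen_ball.mem_nhds (hry.symm ▸ hy))
  obtain ⟨b, hb, hbV, hby⟩ := exists_smooth_retract hV
  have hc : ContMDiff (𝓡 m) (𝓡 m) ∞ (q ∘ (r ∘ b)) := ha.contMDiff.comp (hr.comp hb).contMDiff
  have hπ : ∀ t, π (r t) = π y := fun t ↦ by simp [r, hπκ]
  have hcy : (q ∘ (r ∘ b)) y = q y := by simp [hby.self_of_nhds, hry]
  have h1 := F₁.diffInto_mem_tangent (c := p₁ ∘ (q ∘ (r ∘ b)))
    (hs.right.2.1.contMDiff.comp hc) (z := y) (fun t ↦ by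
      refine (hs.rel_iff _ _).1 ?_
      have h2 : ∀ t, p₀ ((q ∘ (r ∘ b)) t) = p₀ (q y) := fun t ↦ by
        rw [show (q ∘ (r ∘ b)) t = q (r (b t)) from rfl, ha.map_eq (hbV t), ha.map_eq hy]
        exact congrArg ψ.symm (hπ _)
      rw [h2, h2]) e
  have h3 : (diffInto (m := m) q y e : Cart m) = diffInto (m := m) (q ∘ (r ∘ b)) y e := by
    have h4 : HasFDerivAt r κ y := by
      have h := (κ.hasFDerivAt.comp y ((hasFDerivAt_id y).sub_const y)).const_add y
      rwa [ContinuousLinearMap.comp_id] at h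
    have h5 : HasFDerivAt (r ∘ b) κ y :=
      h4.congr_of_eventuallyEq (hby.fun_comp r)
    have h6 := diffInto_comp (p := q) ha.contMDiff (q := r ∘ b) (hr.comp hb).contMDiff y e
    have h7 : (diffInto (m := m) (r ∘ b) y : Cart m →L[ℝ] Cart m) = κ := by
      rw [diffInto, mfderiv_eq_fderiv]
      exact h5.fderiv
    have key : ∀ t t' v v' : Cart m, t = t' → v = v' →
        (mfderiv (𝓡 m) (𝓡 m) q t v : Cart m) = mfderiv (𝓡 m) (𝓡 m) q t' v' := by
      rintro t _ v _ rfl rfl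
      rfl
    refine (key y ((r ∘ b) y) e (diffInto (m := m) (r ∘ b) y e) ?_ ?_).trans h6.symm
    · simp [hby.self_of_nhds, hry]
    · rw [h7]
      exact hκe.symm
  have key : ∀ x x' : M, x = x' → ∀ v v' : Cart n₁, v = v' → v ∈ F₁.tangent (p₁ x) →
      v' ∈ F₁.tangent (p₁ x') := by
    rintro x _ rfl v _ rfl hv
    exact hv
  exact key _ _ hcy _ _
    (diffInto_comp_congr hs.right.2.1.contMDiff ha.contMDiff hc hcy h3).symm h1

omit [IsManifold (𝓡 n₀) ∞ N₀] in
theorem IsSpan.pullback_eq_zero (hs : IsSpan (m := m) F₀ F₁ p₀ p₁) (hη₁ : F₁.IsHorizontal η₁)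
    {ψ : OpenPartialHomeomorph N₀ (Cart n₀)} {π : Cart m →L[ℝ] Cart n₀} {q : Cart m → M}
    {z : Cart m} {ε : ℝ} (ha : IsAdaptedPlot p₀ ψ π q z ε) {y : Cart m}
    (hy : y ∈ Metric.ball z ε) {w : Fin k → Cart m} {i : Fin k} (hw : π (w i) = 0) :
    η₁.pullback (p₁ ∘ q) y w = 0 :=
  hη₁ (p₁ (q y)) (fun j ↦ diffInto (m := n₁) (p₁ ∘ q) y (w j)) i
    (hs.diffInto_mem_tangent ha hy hw)

-- The pullback of η₁ kills the kernel of dp₀, so it factors through dp₀; any linear right inverse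
-- `B` yields the factor.
omit [IsManifold (𝓡 n₀) ∞ N₀] in
theorem IsSpan.exists_agreesAt (hs : IsSpan (m := m) F₀ F₁ p₀ p₁) (hη₁ : F₁.IsHorizontal η₁)
    (x : M) : ∃ ζ : Cart n₀ [⋀^Fin k]→L[ℝ] ℝ, AgreesAt m p₀ p₁ η₁ x ζ := by
  obtain ⟨ψ, π, q, z, ε, ha, rfl⟩ := exists_isAdaptedPlot hs.left.2.1 x
  have hz := Metric.mem_ball_self (x := z) ha.pos
  let A : Cart m →L[ℝ] Cart n₀ := diffInto (m := n₀) (p₀ ∘ q) z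
  have hA : Function.Surjective A := ha.diffInto_surjective hz
  obtain ⟨B, hB⟩ :=
    exists_rightInverse_of_surjective hA
  refine ⟨(η₁.pullback (p₁ ∘ q) z).compContinuousLinearMap B,
    (hs.agreesAt_iff ha.contMDiff (ha.diff_surjective z hz)).2 ?_⟩
  ext a
  exact apply_eq_of_map_eq (β := η₁.pullback (p₁ ∘ q) z)
    (A := A.toLinearMap)
    (fun w i hw ↦ hs.pullback_eq_zero hη₁ ha hz (ha.eq_zero_of_diffInto_eq_zero hz hw))
    fun i ↦ hB _

-- In an adapted plot, points of one fiber differ by a vector of ker π. That vector annihilates the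
-- pullback of η₁ and its exterior derivative, so the pullback is constant along the segment; the
-- differential of `p₀ ∘ q` depends only on π y.
omit [IsManifold (𝓡 n₀) ∞ N₀] in
theorem IsSpan.eventually_agreesAt_iff (hs : IsSpan (m := m) F₀ F₁ p₀ p₁)
    (hη : η₁ ∈ ManifoldForm n₁ N₁ k) (hη₁ : F₁.IsHorizontal η₁) (hdη₁ : F₁.IsHorizontal η₁.d)
    (x : M) : ∀ᶠ x' in 𝓝 x, p₀ x' = p₀ x →
      ∀ ζ : Cart n₀ [⋀^Fin k]→L[ℝ] ℝ, AgreesAt m p₀ p₁ η₁ x ζ ↔ AgreesAt m p₀ p₁ η₁ x' ζ := by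
  obtain ⟨ψ, π, q, z, ε, ha, rfl⟩ := exists_isAdaptedPlot hs.left.2.1 x
  have hz := Metric.mem_ball_self (x := z) ha.pos
  filter_upwards [ha.image_mem_nhds]
  rintro _ ⟨y, hy, rfl⟩ hyz ζ
  rw [hs.agreesAt_iff ha.contMDiff (ha.diff_surjective z hz),
    hs.agreesAt_iff ha.contMDiff (ha.diff_surjective y hy)]
  have hπ : π y = π z := by rw [← ha.apply_eq y hy, ← ha.apply_eq z hz, hyz]
  have hπ' : π (y - z) = 0 := by rw [map_sub, hπ, sub_self]
  have h1 : (diffInto (p₀ ∘ q) y : Cart m →L[ℝ] Cart n₀) = diffInto (p₀ ∘ q) z := by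
    rw [ha.diffInto_eq hy, ha.diffInto_eq hz, hπ]
  have hpq := hs.right.2.1.contMDiff.comp ha.contMDiff
  have h2 : η₁.pullback (p₁ ∘ q) y = η₁.pullback (p₁ ∘ q) z := by
    refine eq_of_contraction_eq_zero (convex_ball z ε) Metric.isOpen_ball
      ((mem_manifoldForm_iff.1 hη _ _ hpq).differentiable (by simp)).differentiableOn hz hy
      (fun t ht w i hi ↦ hs.pullback_eq_zero hη₁ ha ht (i := i) (hi ▸ hπ'))
      (fun t ht w i hi ↦ ?_)
    rw [← FormField.pullback_d hη hpq]
    exact hs.pullback_eq_zero hdη₁ ha ht (i := i) (hi ▸ hπ')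
  rw [h1, h2]

theorem IsSpan.exists_pullbacksAgree [T2Space N₁] (hs : IsSpan (m := m) F₀ F₁ p₀ p₁)
    (hη : η₁ ∈ F₁.basicForms k) : ∃ η₀ : FormField n₀ N₀ k, PullbacksAgree m p₀ p₁ η₀ η₁ := by
  rw [SingularFoliation.mem_basicForms_iff] at hη
  obtain ⟨hη, hη₁, hdη₁⟩ := hη
  have key : ∀ y : N₀, ∃ ζ : Cart n₀ [⋀^Fin k]→L[ℝ] ℝ, ∀ x, p₀ x = y →
      AgreesAt m p₀ p₁ η₁ x ζ := by
    intro y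
    obtain ⟨x, rfl⟩ := hs.left.1 y
    obtain ⟨ζ, hζ⟩ := hs.exists_agreesAt hη₁ x
    refine ⟨ζ, fun x' hx' ↦ ?_⟩
    -- Agreement with a given ζ is locally constant along the fiber, so connectedness spreads it
    -- from `x` to the whole fiber.
    refine ((hs.left.2.2 (p₀ x)).isPreconnected.induction₂ (fun x x' ↦
      ∀ ζ : Cart n₀ [⋀^Fin k]→L[ℝ] ℝ, AgreesAt m p₀ p₁ η₁ x ζ ↔ AgreesAt m p₀ p₁ η₁ x' ζ)
      (fun t ht ↦ ?_) (fun _ _ _ _ _ _ h h' ζ ↦ (h ζ).trans (h' ζ))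
      (fun _ _ _ _ h ζ ↦ (h ζ).symm) rfl hx' ζ).1 hζ
    filter_upwards [nhdsWithin_le_nhds (hs.eventually_agreesAt_iff hη hη₁ hdη₁ t),
      self_mem_nhdsWithin] with t' h1 h2
    exact h1 (h2.trans ht.symm)
  choose η₀ hη₀ using key
  refine ⟨η₀, fun l q hq ↦ funext fun t ↦ ?_⟩
  ext a
  have h1 := hη₀ (p₀ (q t)) (q t) rfl fun i ↦ diffInto (m := m) q t (a i)
  refine Eq.trans ?_ (h1.trans ?_)
  · exact congrArg (η₀ (p₀ (q t)))
      (funext fun i ↦ diffInto_comp hs.left.2.1.contMDiff hq t (a i))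
  · exact congrArg (η₁ (p₁ (q t)))
      (funext fun i ↦ (diffInto_comp hs.right.2.1.contMDiff hq t (a i)).symm)

end Rel

end Span

/-! ### Transport of diffeological forms and of the comparison isomorphism -/

/-- The pullback of diffeological forms along a smooth map of diffeological spaces. -/
def DiffeoForm.comap {X : Type u} {Y : Type v} [DiffeologicalSpace X] [DiffeologicalSpace Y]
    {f : X → Y} (hf : Diffeology.DSmooth f) (k : ℕ) : DiffeoForm Y k →ₗ[ℝ] DiffeoForm X k where
  toFun α := ⟨fun n p ↦ α.1 n ⟨f ∘ p.1, hf n p.1 p.2⟩,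
    fun n _ ↦ α.2.1 n _, fun n l p ↦ α.2.2 n l ⟨f ∘ p.1, hf n p.1 p.2⟩⟩
  map_add' _ _ := rfl
  map_smul' _ _ := rfl

/-- Compatibility with `b`, whose differential at `z` is the identity: diffeological forms may be
evaluated on local lifts. -/
theorem DiffeoForm.apply_comp_of_eventuallyEq_id {X : Type u} [DiffeologicalSpace X] {k n : ℕ}
    (α : DiffeoForm X k) (p : {p : Cart n → X // Diffeology.IsPlot p}) {b : Cart n → Cart n}
    (hb : ContDiff ℝ ∞ b) {z : Cart n} (hbz : b =ᶠ[𝓝 z] id) :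
    α.1 n ⟨p.1 ∘ b, Diffeology.isPlot_reparam p.2 hb⟩ z = α.1 n p z := by
  rw [α.2.2 n n p b hb z, hbz.fderiv_eq, fderiv_id, hbz.self_of_nhds]
  rfl

section Foliation

variable {m : ℕ} {M : Type u} [TopologicalSpace M] [ChartedSpace (Cart m) M]

theorem SingularFoliation.exists_lift_of_isPlot {F : SingularFoliation m M} {n : ℕ}
    {p : Cart n → F.LeafSpace} (hp : Diffeology.IsPlot p) (r : Cart n) :
    ∃ (b : Cart n → Cart n) (q : Cart n → M), ContDiff ℝ ∞ b ∧ b =ᶠ[𝓝 r] id ∧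
      ContMDiff (𝓡 n) (𝓡 m) ∞ q ∧ p ∘ b = F.proj ∘ q := by
  obtain ⟨V, q, hV, hrV, -, hq, e⟩ := hp r trivial
  obtain ⟨b, hb, hbV, hbr⟩ := exists_smooth_retract (hV.mem_nhds hrV)
  exact ⟨b, q ∘ b, hb, hbr, ContMDiffOn.comp_contDiff hq hb hbV, funext fun t ↦ e _ (hbV t)⟩

theorem SingularFoliation.IsPullbackByProj.ext [IsManifold (𝓡 m) ∞ M] {F : SingularFoliation m M}
    {k : ℕ} {α : DiffeoForm F.LeafSpace k} {η η' : FormField m M k}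
    (h : F.IsPullbackByProj α η) (h' : F.IsPullbackByProj α η') : η = η' :=
  FormField.ext_of_pullback fun q hq ↦ (h _ q hq).trans (h' _ q hq).symm

theorem SingularFoliation.IsPullbackByProj.d [IsManifold (𝓡 m) ∞ M] {F : SingularFoliation m M}
    {k : ℕ} {α : DiffeoForm F.LeafSpace k} {η : FormField m M k} (h : F.IsPullbackByProj α η)
    (hη : η ∈ ManifoldForm m M k) : F.IsPullbackByProj (DiffeoForm.d α) η.d := by
  intro n q hq
  rw [FormField.pullback_d hη hq, h n q hq]
  rfl

end Foliation

section Span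

variable {n₀ n₁ m : ℕ}
  {N₀ : Type u} [TopologicalSpace N₀] [ChartedSpace (Cart n₀) N₀]
  {N₁ : Type v} [TopologicalSpace N₁] [ChartedSpace (Cart n₁) N₁]
  {M : Type w} [TopologicalSpace M] [ChartedSpace (Cart m) M]
  {F₀ : SingularFoliation n₀ N₀} {F₁ : SingularFoliation n₁ N₁} {p₀ : M → N₀} {p₁ : M → N₁}

namespace IsSpan

theorem surjective_left (hs : IsSpan (m := m) F₀ F₁ p₀ p₁) : Function.Surjective p₀ :=
  hs.left.1

/-- The map of leaf spaces induced by a span. -/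
def leafMap (hs : IsSpan (m := m) F₀ F₁ p₀ p₁) : F₀.LeafSpace → F₁.LeafSpace :=
  Quotient.lift (fun y ↦ F₁.proj (p₁ (Function.surjInv hs.surjective_left y))) fun y y' h ↦
    Quotient.sound <| (hs.rel_iff _ _).1 <| by
      rw [Function.surjInv_eq hs.surjective_left, Function.surjInv_eq hs.surjective_left]
      exact h

theorem leafMap_proj (hs : IsSpan (m := m) F₀ F₁ p₀ p₁) (x : M) :
    hs.leafMap (F₀.proj (p₀ x)) = F₁.proj (p₁ x) :=
  Quotient.sound <| (hs.rel_iff _ _).1 <| by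
    rw [Function.surjInv_eq hs.surjective_left]

theorem leafMap_leafMap (hs : IsSpan (m := m) F₀ F₁ p₀ p₁) (a : F₀.LeafSpace) :
    hs.symm.leafMap (hs.leafMap a) = a := by
  obtain ⟨y, rfl⟩ : ∃ y, F₀.proj y = a := Quotient.exists_rep a
  obtain ⟨x, rfl⟩ := hs.left.1 y
  rw [leafMap_proj, leafMap_proj]

/-- Lift a plot of the leaf space locally to `N₀`, then through `p₀` to `M`, and project by `p₁`. -/
theorem dSmooth_leafMap (hs : IsSpan (m := m) F₀ F₁ p₀ p₁) : Diffeology.DSmooth hs.leafMap := by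
  intro n p hp r _
  obtain ⟨b, q, hb, hbr, hq, hpq⟩ := SingularFoliation.exists_lift_of_isPlot hp r
  obtain ⟨x, hx⟩ := hs.left.1 (q r)
  obtain ⟨b', d, hb', hbr', hd, -, hqd⟩ := exists_lift_of_isSubmersion hs.left.2.1 hq hx.symm
  -- Each lift costs a reparametrization; both are the identity near `r`, so they disappear on a
  -- smaller neighbourhood.
  have h1 : ∀ᶠ z in 𝓝 r, b (b' z) = z := by
    have h2 : Filter.Tendsto b' (𝓝 r) (𝓝 r) := by
      have h3 := hb'.continuous.tendsto r
      rwa [hbr'.self_of_nhds] at h3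
    filter_upwards [hbr', h2.eventually hbr] with z hz hz'
    rw [hz', hz]
    rfl
  obtain ⟨V, hV, hVo, hrV⟩ := mem_nhds_iff.1 h1
  refine ⟨V, p₁ ∘ d, hVo, hrV, Set.subset_univ _,
    (hs.right.2.1.contMDiff.comp hd).contMDiffOn, fun z hz ↦ ?_⟩
  have h4 : p z = F₀.proj (p₀ (d z)) := by
    have h5 : p (b (b' z)) = F₀.proj (q (b' z)) := congrFun hpq (b' z)
    have h6 : p₀ (d z) = q (b' z) := congrFun hqd z
    rw [h6, ← h5, show b (b' z) = z from hV hz]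
  rw [Function.comp_apply, h4, leafMap_proj]
  rfl

/-- Diffeological forms on the two leaf spaces of a span correspond to each other. -/
def diffeoFormEquiv (hs : IsSpan (m := m) F₀ F₁ p₀ p₁) (k : ℕ) :
    DiffeoForm F₁.LeafSpace k ≃ₗ[ℝ] DiffeoForm F₀.LeafSpace k :=
  LinearEquiv.ofLinearMap (DiffeoForm.comap hs.dSmooth_leafMap k)
    (DiffeoForm.comap hs.symm.dSmooth_leafMap k)
    (LinearMap.ext fun α ↦ Subtype.ext <| funext fun n ↦ funext fun _ ↦
      congrArg (α.1 n) (Subtype.ext (funext fun _ ↦ hs.leafMap_leafMap _)))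
    (LinearMap.ext fun α ↦ Subtype.ext <| funext fun n ↦ funext fun _ ↦
      congrArg (α.1 n) (Subtype.ext (funext fun _ ↦ hs.symm.leafMap_leafMap _)))

variable [IsManifold (𝓡 n₀) ∞ N₀] [IsManifold (𝓡 n₁) ∞ N₁]

/-- The pairs of basic forms with the same pullback to the apex of a span. -/
def basicFormsGraph (_ : IsSpan (m := m) F₀ F₁ p₀ p₁) (k : ℕ) :
    Submodule ℝ (F₀.basicForms k × F₁.basicForms k) where
  carrier := {x | PullbacksAgree m p₀ p₁ (x.1 : FormField n₀ N₀ k) (x.2 : FormField n₁ N₁ k)}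
  add_mem' := fun h h' l q hq ↦ congrArg₂ (· + ·) (h l q hq) (h' l q hq)
  zero_mem' := fun _ _ _ ↦ rfl
  smul_mem' := fun c _ h l q hq ↦ congrArg (c • ·) (h l q hq)

variable [T2Space N₀] [T2Space N₁]

/-- Injectivity is uniqueness of descent along `p₁`, surjectivity its existence. Working with the
graph gives a linear correspondence without choosing descended forms. -/
theorem bijective_fst_basicFormsGraph (hs : IsSpan (m := m) F₀ F₁ p₀ p₁) (k : ℕ) :
    Function.Bijective ((LinearMap.fst ℝ _ _).comp (hs.basicFormsGraph k).subtype) := by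
  constructor
  · rintro ⟨⟨η₀, η₁⟩, h⟩ ⟨⟨η₀', η₁'⟩, h'⟩ heq
    have h1 : η₀ = η₀' := heq
    subst h1
    have h2 : η₁ = η₁' := Subtype.ext
      (PullbacksAgree.eq_left (PullbacksAgree.symm h) (PullbacksAgree.symm h') hs.symm)
    subst h2
    rfl
  · intro η₀
    obtain ⟨η₁, h⟩ := hs.symm.exists_pullbacksAgree η₀.2
    exact ⟨⟨⟨η₀, ⟨η₁, h.mem_basicForms η₀.2 hs.symm⟩⟩, h.symm⟩, rfl⟩

theorem bijective_snd_basicFormsGraph (hs : IsSpan (m := m) F₀ F₁ p₀ p₁) (k : ℕ) :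
    Function.Bijective ((LinearMap.snd ℝ _ _).comp (hs.basicFormsGraph k).subtype) := by
  constructor
  · rintro ⟨⟨η₀, η₁⟩, h⟩ ⟨⟨η₀', η₁'⟩, h'⟩ heq
    have h1 : η₁ = η₁' := heq
    subst h1
    have h2 : η₀ = η₀' := Subtype.ext (PullbacksAgree.eq_left h h' hs)
    subst h2
    rfl
  · intro η₁
    obtain ⟨η₀, h⟩ := hs.exists_pullbacksAgree η₁.2
    exact ⟨⟨⟨⟨η₀, h.mem_basicForms η₁.2 hs⟩, η₁⟩, h⟩, rfl⟩

/-- The basic forms at the two ends of a span correspond to each other. -/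
def basicFormsEquiv (hs : IsSpan (m := m) F₀ F₁ p₀ p₁) (k : ℕ) :
    F₀.basicForms k ≃ₗ[ℝ] F₁.basicForms k :=
  (LinearEquiv.ofBijective _ (hs.bijective_fst_basicFormsGraph k)).symm.trans
    (LinearEquiv.ofBijective _ (hs.bijective_snd_basicFormsGraph k))

theorem pullbacksAgree_basicFormsEquiv (hs : IsSpan (m := m) F₀ F₁ p₀ p₁) {k : ℕ}
    (η : F₀.basicForms k) : PullbacksAgree m p₀ p₁ (η : FormField n₀ N₀ k)
      (hs.basicFormsEquiv k η : FormField n₁ N₁ k) := by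
  set x := (LinearEquiv.ofBijective _ (hs.bijective_fst_basicFormsGraph k)).symm η
  have h1 : x.1.1 = η :=
    (LinearEquiv.ofBijective _ (hs.bijective_fst_basicFormsGraph k)).apply_symm_apply η
  have h2 : PullbacksAgree m p₀ p₁ (x.1.1 : FormField n₀ N₀ k)
    (hs.basicFormsEquiv k η : FormField n₁ N₁ k) := x.2
  rwa [h1] at h2

-- Lift a plot of `N₁` locally to a plot `d` of `M`. There η₁ is read off from η₀ on `p₀ ∘ d`, and
-- `leafMap` carries the class of `p₀ ∘ d` to that of `p₁ ∘ d`.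
omit [IsManifold (𝓡 n₀) ∞ N₀] [IsManifold (𝓡 n₁) ∞ N₁] [T2Space N₀] [T2Space N₁] in
theorem isPullbackByProj (hs : IsSpan (m := m) F₀ F₁ p₀ p₁) {k : ℕ}
    {α : DiffeoForm F₁.LeafSpace k} {η₀ : FormField n₀ N₀ k} {η₁ : FormField n₁ N₁ k}
    (h : PullbacksAgree m p₀ p₁ η₀ η₁) (hα : F₀.IsPullbackByProj (hs.diffeoFormEquiv k α) η₀) :
    F₁.IsPullbackByProj α η₁ := by
  intro n q hq
  funext t
  obtain ⟨x, hx⟩ := hs.right.1 (q t)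
  obtain ⟨b, d, hb, hbt, hd, -, hqd⟩ := exists_lift_of_isSubmersion hs.right.2.1 hq hx.symm
  refine Eq.trans ?_ (DiffeoForm.apply_comp_of_eventuallyEq_id α
    ⟨F₁.proj ∘ q, F₁.isPlot_proj_comp q hq⟩ hb hbt)
  rw [← FormField.pullback_comp_eq_of_eventuallyEq_id η₁ q hbt, ← hqd,
    ← h n d hd, hα n _ (hs.left.2.1.contMDiff.comp hd)]
  refine congrFun (congrArg (α.1 n) (Subtype.ext (funext fun s ↦ ?_))) t
  have h1 : p₁ (d s) = q (b s) := congrFun hqd s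
  exact (hs.leafMap_proj (d s)).trans (congrArg F₁.proj h1)

theorem pullbackIsIso (hs : IsSpan (m := m) F₀ F₁ p₀ p₁) (h : F₀.PullbackIsIso) :
    F₁.PullbackIsIso := by
  obtain ⟨Φ, hΦ, -⟩ := h
  have key : ∀ k α, F₁.IsPullbackByProj α
      (hs.basicFormsEquiv k (Φ k (hs.diffeoFormEquiv k α)) : FormField n₁ N₁ k) := fun k α ↦
    hs.isPullbackByProj (hs.pullbacksAgree_basicFormsEquiv _) (hΦ k _)
  refine ⟨fun k ↦ (hs.diffeoFormEquiv k).trans ((Φ k).trans (hs.basicFormsEquiv k)), key,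
    fun k α ↦ ?_⟩
  -- Both sides are pullbacks of dα, and a pullback is unique.
  exact (key (k + 1) (DiffeoForm.d α)).ext
    ((key k α).d (Subtype.property _ : _ ∈ F₁.basicForms k).1)

end IsSpan

end Span

end

end SingFol

theorem proposition11 {n₀ n₁ : ℕ}
    {N₀ : Type u} [TopologicalSpace N₀] [ChartedSpace (SingFol.Cart n₀) N₀]
    [IsManifold (𝓡 n₀) ∞ N₀] [T2Space N₀] [SecondCountableTopology N₀]
    {N₁ : Type v} [TopologicalSpace N₁] [ChartedSpace (SingFol.Cart n₁) N₁]
    [IsManifold (𝓡 n₁) ∞ N₁] [T2Space N₁] [SecondCountableTopology N₁]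
    (F₀ : SingFol.SingularFoliation n₀ N₀) (F₁ : SingFol.SingularFoliation n₁ N₁)
    (hF : SingFol.MolinoEquivalent.{u, v, w} F₀ F₁)
    (h₀ : F₀.PullbackIsIso) : F₁.PullbackIsIso := by
  obtain ⟨m, M, _, _, _, p₀, p₁, hs⟩ := hF.exists_isSpan
  exact hs.pullbackIsIso h₀
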